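/- Let $G$ be a connected unimodular transitive (simple) graph with vertex set $V$ in which every vertex has degree $d<\infty$. Here *transitive* means that the automorphism group $\mathrm{Aut}(G)$ acts transitively on $V$, and *unimodular* means that the Mass-Transport Principle holds: $\sum_{v\in V}h(o,v)=\sum_{v\in V}h(v,o)$ for every $o\in V$ and every $h\colon V\times V\to[0,\infty)$ such that $h(\varphi(u),\varphi(v))=h(u,v)$ for all $\varphi\in\mathrm{Aut}(G)$ and $u,v\in V$. Let $M$ be a finite set and let $X=(X_v)_{v\in V}$ be an $M$-valued $\mathrm{Aut}(G)$-factor-of-IID process, that is, $X$ has the law of $F(Z)$, where $Z=(Z_v)_{v\in V}$ are independent uniform $[0,1]$ random variables and $F\colon[0,1]^V\to M^V$ is measurable and $\mathrm{Aut}(G)$-equivariant. Then, for every $o\in V$, $$\frac12\sum_{o'\sim o}H(X_o,X_{o'})\ \ge\ \beta\,H(X_o),\qquad \beta=\frac12\left(d+\inf_{W\subset V,\ 0<|W|<\infty}\frac{|\partial W|}{|W|}\right),$$ where $H$ denotes Shannon entropy, $o'$ runs through the neighbors of $o$, and $\partial W$ is the set of edges with one endpoint in $W$ and one endpoint outside $W$;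 the infimum is the edge Cheeger constant of $G$. In particular, if $G=T_d$ is the $d$-regular tree, $d\ge2$, then its edge Cheeger constant is $d-2$, and every finite-valued $\mathrm{Aut}(T_d)$-factor-of-IID process $X$ satisfies $H(X_u,X_v)\ge\frac{2(d-1)}{d}H(X_v)$ for every edge $(u,v)$. -/

import Mathlib

open MeasureTheory ProbabilityTheory
open scoped NNReal ENNReal

namespace FactorOfIID

/-- A graph is (vertex-)transitive if its automorphism group acts transitively on the vertices. -/
def IsVertexTransitive {V : Type*} (G : SimpleGraph V) : Prop :=
  ∀ u v : V, ∃ φ : G ≃g G, φ u = v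

/-- `h` is diagonally `Aut(G)`-invariant. -/
def IsDiagonallyInvariant {V : Type*} (G : SimpleGraph V) (h : V → V → ℝ≥0) : Prop :=
  ∀ (φ : G ≃g G) (u v : V), h (φ u) (φ v) = h u v

/-- Unimodularity of a (transitive) graph, in the form of the Mass-Transport Principle.
The sums are taken in `[0, ∞]`. -/
def IsUnimodular {V : Type*} (G : SimpleGraph V) : Prop :=
  ∀ h : V → V → ℝ≥0, IsDiagonallyInvariant G h →
    ∀ o : V, ∑' v : V, (h o v : ℝ≥0∞) = ∑' v : V, (h v o : ℝ≥0∞)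

/-- The edge boundary of a finite vertex set `W`: the edges with one endpoint in `W` and one
endpoint outside `W`. -/
def edgeBoundary {V : Type*} (G : SimpleGraph V) (W : Finset V) : Set (Sym2 V) :=
  {e | e ∈ G.edgeSet ∧ ∃ u ∈ W, ∃ v ∉ W, e = s(u, v)}

/-- The edge Cheeger constant of a locally finite graph: the infimum of `|∂W| / |W|` over the
nonempty finite vertex sets `W`. -/
noncomputable def cheegerConstant {V : Type*} (G : SimpleGraph V) : ℝ :=
  ⨅ W : {W : Finset V // W.Nonempty},
    ((edgeBoundary G W.1).ncard : ℝ) / (W.1.card : ℝ)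

/-- The Shannon entropy (natural logarithm) of a random variable `Y` with values in a
finite set. -/
noncomputable def entropy {Ω S : Type*} [MeasurableSpace Ω] [Fintype S]
    (P : Measure Ω) (Y : Ω → S) : ℝ :=
  ∑ s : S, Real.negMulLog (P.real (Y ⁻¹' {s}))

/-- The law of an IID process indexed by `V`, each variable being uniform on `[0,1]`. -/
noncomputable def iidLaw (V : Type*) : Measure (V → unitInterval) :=
  Measure.infinitePi fun _ : V => (volume : Measure unitInterval)

/-- `F : [0,1]^V → M^V` is `Aut(G)`-equivariant. As `φ` runs over the whole group, it does not
matter whether `φ` or its inverse is used to act on the labellings. -/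
def IsEquivariant {V M : Type*} (G : SimpleGraph V)
    (F : (V → unitInterval) → (V → M)) : Prop :=
  ∀ (φ : G ≃g G) (z : V → unitInterval), F (z ∘ φ) = F z ∘ φ

/-- The process `X = (X_v)` on the probability space `(Ω, P)` is an `Aut(G)`-factor of IID: it has
the joint law of `F(Z)` for an IID uniform process `Z` and a measurable equivariant `F`. -/
def IsFactorOfIID {V M Ω : Type*} [MeasurableSpace M] [MeasurableSpace Ω]
    (G : SimpleGraph V) (P : Measure Ω) (X : V → Ω → M) : Prop :=
  ∃ F : (V → unitInterval) → (V → M),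
    Measurable F ∧ IsEquivariant G F ∧
      IdentDistrib (fun ω v => X v ω) F P (iidLaw V)

end FactorOfIID

/-! Write `X_v = F(Z)_v`, and first suppose that each label depends on finitely many seeds. The set
function `S ↦ I(X_v; Z_S)` is a cooperative game whose players are the seeds; let `f(j,v)` be the
Shapley share of the seed `j`. Shares are nonnegative, commute with automorphisms, and sum over `j`
to `H(X_v)`.

Because the seeds are independent, the marginal information of a seed grows when more seeds are
known and when the variable is refined (`info_sub_le`). As Shapley values are monotone in marginals,
`f(j,u)` and `f(j,v)` are both at most the share of `j` in the game of the pair, so `∑_j max(f(j,u),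
f(j,v)) ≤ H(X_u, X_v)`.

Now `max(a,b) = b + (a-b)⁺`. Summed over the neighbors `o'` of `o` and over `j`, the terms `f(j,o')`
give `d·H(X_o)`. By mass transport the positive parts total `∑_v ∑_{v'∼v} (f(o,v) - f(o,v'))⁺`, the
total drop of the single function `f(o,·)` along edges. The functional form of the Cheeger
inequality bounds this below by the Cheeger constant times `∑_v f(o,v)`, which is again `H(X_o)` by
mass transport.

In general only the seeds in a ball of radius `r` around `v` play, and the information they carry
tends to `H(X_v)` by martingale convergence.

A regular tree is distance-transitive, which gives transitivity, unimodularity (two vertices can be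
swapped) and equality of the pair entropies over all edges; its Cheeger constant comes from counting
edges in finite forests. -/

open MeasureTheory ProbabilityTheory
open scoped NNReal ENNReal

namespace FactorOfIID

/-! ### Shapley values of finite cooperative games -/

section Shapley

open Classical in
/-- The Shapley value of the player `j` in the restriction of the game `h` to `B`, by the
recursion over subgames. -/
noncomputable def shapley {V : Type*} (h : Finset V → ℝ) (j : V) (B : Finset V) : ℝ :=
  if j ∈ B then
    (h B - h (B.erase j) + ∑ i ∈ (B.erase j).attach, shapley h j (B.erase i.1)) / B.card
  else 0
termination_by B.card
decreasing_by
  exact Finset.card_erase_lt_of_mem (Finset.mem_of_mem_erase i.2)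

variable {V : Type*} (h : Finset V → ℝ) (j : V) (B : Finset V)

theorem shapley_of_notMem {j : V} {B : Finset V} (hj : j ∉ B) : shapley h j B = 0 := by
  rw [shapley, if_neg hj]

theorem shapley_of_mem [DecidableEq V] {j : V} {B : Finset V} (hj : j ∈ B) :
    shapley h j B =
      (h B - h (B.erase j) + ∑ i ∈ B.erase j, shapley h j (B.erase i)) / B.card := by
  rw [shapley, if_pos hj]
  have := Finset.sum_attach (B.erase j) (fun i => shapley h j (B.erase i))
  rw [← this]
  congr!

/-- Condition on who arrives last in a uniformly random order on `B`: either `j`, who then brings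
the last marginal contribution, or some other `i`, which leaves the game on `B.erase i`. -/
theorem card_mul_shapley [DecidableEq V] {j : V} {B : Finset V} (hj : j ∈ B) :
    B.card * shapley h j B =
      h B - h (B.erase j) + ∑ i ∈ B.erase j, shapley h j (B.erase i) := by
  have : (B.card : ℝ) ≠ 0 := by
    simpa [Finset.card_eq_zero] using Finset.ne_empty_of_mem hj
  rw [shapley_of_mem h hj]
  field_simp

/-- The Shapley values share the worth of the whole coalition. -/
theorem sum_shapley : ∑ j ∈ B, shapley h j B = h B - h ∅ := by
  classical
  induction B using Finset.strongInduction with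
  | H B ih =>
    rcases B.eq_empty_or_nonempty with rfl | hB
    · simp
    have hc : (B.card : ℝ) ≠ 0 := by simpa [Finset.card_eq_zero] using hB.ne_empty
    have key : (B.card : ℝ) * ∑ j ∈ B, shapley h j B = B.card * (h B - h ∅) := by
      rw [Finset.mul_sum, Finset.sum_congr rfl fun j hj => card_mul_shapley h hj,
        Finset.sum_add_distrib]
      have h1 : ∑ j ∈ B, ∑ i ∈ B.erase j, shapley h j (B.erase i) =
          ∑ i ∈ B, ∑ j ∈ B.erase i, shapley h j (B.erase i) := by
        refine Finset.sum_comm' fun x y => ?_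
        simp only [Finset.mem_erase]
        tauto
      rw [h1, Finset.sum_congr rfl fun i hi => ih _ (Finset.erase_ssubset hi),
        ← Finset.sum_add_distrib]
      simp [mul_sub]
    exact mul_left_cancel₀ hc key

/-- The Shapley value is monotone in the marginal contributions. -/
theorem shapley_mono [DecidableEq V] {h k : Finset V → ℝ} {j : V}
    (hk : ∀ S : Finset V, j ∉ S → h (insert j S) - h S ≤ k (insert j S) - k S) :
    shapley h j B ≤ shapley k j B := by
  induction B using Finset.strongInduction with
  | H B ih =>
    by_cases hj : j ∈ B
    · rw [shapley_of_mem h hj, shapley_of_mem k hj]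
      have h1 := hk (B.erase j) (Finset.notMem_erase j B)
      rw [Finset.insert_erase hj] at h1
      have h2 : ∑ i ∈ B.erase j, shapley h j (B.erase i) ≤
          ∑ i ∈ B.erase j, shapley k j (B.erase i) :=
        Finset.sum_le_sum fun i hi => ih _ (Finset.erase_ssubset (Finset.mem_of_mem_erase hi))
      gcongr
    · rw [shapley_of_notMem h hj, shapley_of_notMem k hj]

theorem shapley_nonneg [DecidableEq V] {h : Finset V → ℝ} {j : V}
    (hh : ∀ S : Finset V, j ∉ S → h S ≤ h (insert j S)) :
    0 ≤ shapley h j B := by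
  induction B using Finset.strongInduction with
  | H B ih =>
    by_cases hj : j ∈ B
    · rw [shapley_of_mem h hj]
      have h1 := hh (B.erase j) (Finset.notMem_erase j B)
      rw [Finset.insert_erase hj] at h1
      have h2 : 0 ≤ ∑ i ∈ B.erase j, shapley h j (B.erase i) :=
        Finset.sum_nonneg fun i hi => ih _ (Finset.erase_ssubset (Finset.mem_of_mem_erase hi))
      apply div_nonneg _ (Nat.cast_nonneg _)
      linarith
    · rw [shapley_of_notMem h hj]

/-- Dummy players can be removed from the game. -/
theorem shapley_inter [DecidableEq V] {h : Finset V → ℝ} {D : Finset V}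
    (hD : ∀ S : Finset V, h S = h (S ∩ D)) (j : V) :
    shapley h j B = shapley h j (B ∩ D) := by
  induction B using Finset.strongInduction with
  | H B ih =>
    by_cases hj : j ∈ B
    swap
    · rw [shapley_of_notMem h hj, shapley_of_notMem h fun h => hj (Finset.mem_inter.1 h).1]
    by_cases hjD : j ∈ D
    · have hc : (B.card : ℝ) ≠ 0 := by
        simpa [Finset.card_eq_zero] using Finset.ne_empty_of_mem hj
      have hjBD : j ∈ B ∩ D := Finset.mem_inter.2 ⟨hj, hjD⟩
      have key : (B.card : ℝ) * shapley h j B = B.card * shapley h j (B ∩ D) := by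
        rw [card_mul_shapley h hj]
        -- A last player in `D` reduces to the recursion on `B ∩ D`; a last player outside `D` is a
        -- dummy and leaves the share in `B ∩ D` unchanged.
        have hsplit : ∑ i ∈ B.erase j, shapley h j (B.erase i) =
            ∑ i ∈ (B ∩ D).erase j, shapley h j ((B ∩ D).erase i) +
              (B \ D).card * shapley h j (B ∩ D) := by
          have hu : B.erase j = (B ∩ D).erase j ∪ B \ D := by
            ext x
            simp only [Finset.mem_erase, Finset.mem_union, Finset.mem_inter, Finset.mem_sdiff]
            grind
          have hdis : Disjoint ((B ∩ D).erase j) (B \ D) := by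
            rw [Finset.disjoint_left]
            grind
          rw [hu, Finset.sum_union hdis]
          congr 1
          · refine Finset.sum_congr rfl fun i hi => ?_
            rw [ih _ (Finset.erase_ssubset (by grind)), Finset.erase_inter]
          · rw [Finset.sum_congr rfl fun i hi => ?_, Finset.sum_const, nsmul_eq_mul]
            rw [ih _ (Finset.erase_ssubset (by grind)), Finset.erase_inter,
              Finset.erase_eq_of_notMem (by grind)]
        rw [hsplit, hD B, hD (B.erase j), Finset.erase_inter, ← add_assoc,
          ← card_mul_shapley h hjBD, ← add_mul, ← Nat.cast_add,
          Finset.card_inter_add_card_sdiff]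
      exact mul_left_cancel₀ hc key
    · rw [shapley_of_notMem h fun h => hjD (Finset.mem_inter.1 h).2, shapley_of_mem h hj]
      have h1 : h B - h (B.erase j) = 0 := by
        rw [hD B, hD (B.erase j), Finset.erase_inter, Finset.erase_eq_of_notMem (by grind),
          sub_self]
      rw [h1, Finset.sum_eq_zero fun i hi => ?_]
      · simp
      · rw [ih _ (Finset.erase_ssubset (Finset.mem_of_mem_erase hi)),
          shapley_of_notMem h (by grind)]

theorem shapley_map {W : Type*} (e : V ↪ W) (h : Finset W → ℝ) (j : V) :
    shapley h (e j) (B.map e) = shapley (fun S => h (S.map e)) j B := by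
  classical
  induction B using Finset.strongInduction with
  | H B ih =>
    by_cases hj : j ∈ B
    · rw [shapley_of_mem _ hj, shapley_of_mem h (by simpa using hj : e j ∈ B.map e),
        ← Finset.map_erase, Finset.sum_map, Finset.card_map]
      congr 2
      refine Finset.sum_congr rfl fun i hi => ?_
      rw [← Finset.map_erase, ih _ (Finset.erase_ssubset (Finset.mem_of_mem_erase hi))]
    · rw [shapley_of_notMem _ hj, shapley_of_notMem]
      simpa using hj

end Shapley

/-! ### Averaging out independent seeds -/

section Averaging

variable {V : Type*}

instance : IsProbabilityMeasure (iidLaw V) := by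
  unfold iidLaw
  infer_instance

open Classical in
/-- The configuration that agrees with `z` on `S` and with `w` off `S`. -/
noncomputable def merge (S : Set V) (z w : V → unitInterval) : V → unitInterval :=
  fun v => if v ∈ S then z v else w v

theorem merge_of_mem {S : Set V} {v : V} (hv : v ∈ S) (z w : V → unitInterval) :
    merge S z w v = z v := if_pos hv

theorem merge_of_notMem {S : Set V} {v : V} (hv : v ∉ S) (z w : V → unitInterval) :
    merge S z w v = w v := if_neg hv

theorem measurable_merge (S : Set V) :
    Measurable fun p : (V → unitInterval) × (V → unitInterval) => merge S p.1 p.2 := by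
  refine measurable_pi_lambda _ fun v => ?_
  by_cases hv : v ∈ S
  · simp only [merge_of_mem hv]; fun_prop
  · simp only [merge_of_notMem hv]; fun_prop

/-- Splicing two independent copies along `S` gives an IID configuration again: the probability of a
cylinder factors over its coordinates inside and outside `S`. -/
theorem map_merge (S : Set V) :
    ((iidLaw V).prod (iidLaw V)).map (fun p => merge S p.1 p.2) = iidLaw V := by
  classical
  refine Measure.eq_infinitePi _ fun s t ht => ?_
  rw [Measure.map_apply (measurable_merge S) (.pi s.countable_toSet fun i hi => ht i)]
  have hpre : (fun p : (V → unitInterval) × (V → unitInterval) => merge S p.1 p.2) ⁻¹'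
      (Set.pi s t) = (Set.pi (s.filter (· ∈ S) : Finset V) t) ×ˢ
        (Set.pi (s.filter (· ∉ S) : Finset V) t) := by
    ext ⟨z, w⟩
    simp only [Set.mem_preimage, Set.mem_pi, Set.mem_prod, Finset.mem_coe, Finset.mem_filter]
    constructor
    · intro h
      exact ⟨fun i hi => by simpa only [merge_of_mem hi.2] using h i hi.1,
        fun i hi => by simpa only [merge_of_notMem hi.2] using h i hi.1⟩
    · rintro ⟨h1, h2⟩ i hi
      by_cases hS : i ∈ S
      · simpa only [merge_of_mem hS] using h1 i ⟨hi, hS⟩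
      · simpa only [merge_of_notMem hS] using h2 i ⟨hi, hS⟩
  rw [hpre, Measure.prod_prod, iidLaw, Measure.infinitePi_pi _ fun i _ => ht i,
    Measure.infinitePi_pi _ fun i _ => ht i, Finset.prod_filter_mul_prod_filter_not]

/-- The average of `f` over the coordinates off `S`. -/
noncomputable def avg (S : Set V) (f : (V → unitInterval) → ℝ) (z : V → unitInterval) : ℝ :=
  ∫ w, f (merge S z w) ∂iidLaw V

/-- Measurable functions with values in `[0, 1]`. -/
structure IsUnitValued (f : (V → unitInterval) → ℝ) : Prop where
  measurable : Measurable f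
  nonneg : ∀ z, 0 ≤ f z
  le_one : ∀ z, f z ≤ 1

theorem integrable_of_abs_le {f : (V → unitInterval) → ℝ} (hf : Measurable f) (C : ℝ)
    (hC : ∀ z, |f z| ≤ C) : Integrable f (iidLaw V) :=
  Integrable.of_bound hf.aestronglyMeasurable C (.of_forall hC)

theorem IsUnitValued.integrable {f : (V → unitInterval) → ℝ} (hf : IsUnitValued f) :
    Integrable f (iidLaw V) :=
  integrable_of_abs_le hf.measurable 1 fun z => abs_le.2 ⟨by linarith [hf.nonneg z], hf.le_one z⟩

theorem measurable_merge_right (S : Set V) (z : V → unitInterval) : Measurable (merge S z) :=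
  (measurable_merge S).comp measurable_prodMk_left

theorem measurable_avg (S : Set V) {f : (V → unitInterval) → ℝ} (hf : Measurable f) :
    Measurable (avg S f) := by
  have : StronglyMeasurable fun p : (V → unitInterval) × (V → unitInterval) =>
      f (merge S p.1 p.2) := (hf.comp (measurable_merge S)).stronglyMeasurable
  exact this.integral_prod_right.measurable

theorem IsUnitValued.comp_merge {f : (V → unitInterval) → ℝ} (hf : IsUnitValued f) (S : Set V)
    (z : V → unitInterval) : IsUnitValued fun w => f (merge S z w) :=
  ⟨hf.measurable.comp (measurable_merge_right S z), fun _ => hf.nonneg _, fun _ => hf.le_one _⟩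

theorem IsUnitValued.avg {f : (V → unitInterval) → ℝ} (hf : IsUnitValued f) (S : Set V) :
    IsUnitValued (avg S f) where
  measurable := measurable_avg S hf.measurable
  nonneg z := integral_nonneg fun _ => hf.nonneg _
  le_one z := by
    calc ∫ w, f (merge S z w) ∂iidLaw V ≤ ∫ _, (1 : ℝ) ∂iidLaw V :=
          integral_mono (hf.comp_merge S z).integrable (integrable_const _) fun _ => hf.le_one _
      _ = 1 := by simp

theorem integral_avg (S : Set V) {f : (V → unitInterval) → ℝ} (hf : Measurable f) (C : ℝ)
    (hC : ∀ z, |f z| ≤ C) : ∫ z, avg S f z ∂iidLaw V = ∫ z, f z ∂iidLaw V := by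
  have hi : Integrable (fun p : (V → unitInterval) × (V → unitInterval) => f (merge S p.1 p.2))
      ((iidLaw V).prod (iidLaw V)) :=
    Integrable.of_bound (hf.comp (measurable_merge S)).aestronglyMeasurable C
      (.of_forall fun _ => hC _)
  calc ∫ z, avg S f z ∂iidLaw V
      = ∫ p, f (merge S p.1 p.2) ∂((iidLaw V).prod (iidLaw V)) := (integral_prod _ hi).symm
    _ = ∫ z, f z ∂(((iidLaw V).prod (iidLaw V)).map fun p => merge S p.1 p.2) :=
        (integral_map (measurable_merge S).aemeasurable hf.aestronglyMeasurable).symm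
    _ = ∫ z, f z ∂iidLaw V := by rw [map_merge]

/-- Independence of the seeds in its decisive form: conditioning on `T` and then on `S` amounts to
conditioning on `S ∩ T`. -/
theorem avg_avg (S T : Set V) {f : (V → unitInterval) → ℝ} (hf : IsUnitValued f) :
    avg S (avg T f) = avg (S ∩ T) f := by
  funext z
  have hm : ∀ w w', merge T (merge S z w) w' = merge (S ∩ T) z (merge T w w') := by
    intro w w'
    funext v
    by_cases h1 : v ∈ S <;> by_cases h2 : v ∈ T <;> simp [merge, h1, h2]
  have hu := hf.comp_merge (S ∩ T) z
  have := integral_avg T hu.measurable 1 fun z => abs_le.2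
    ⟨by linarith [hu.nonneg z], hu.le_one z⟩
  rw [avg, avg, ← this]
  simp only [avg, hm]

theorem dependsOn_avg (S : Set V) (f : (V → unitInterval) → ℝ) : DependsOn (avg S f) S := by
  intro x y hxy
  have : merge S x = merge S y := by
    funext w v
    by_cases hv : v ∈ S
    · simp [merge, hv, hxy v hv]
    · simp [merge, hv]
  simp only [avg, this]

theorem avg_mul_of_dependsOn {S : Set V} {k : (V → unitInterval) → ℝ} (hk : DependsOn k S)
    (f : (V → unitInterval) → ℝ) (z : V → unitInterval) :
    avg S (fun z => k z * f z) z = k z * avg S f z := by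
  rw [avg, avg, ← integral_const_mul]
  congr with w
  rw [hk fun i hi => merge_of_mem hi z w]

theorem integral_mul_avg {S : Set V} {k f : (V → unitInterval) → ℝ} (hk : DependsOn k S)
    (hkm : Measurable k) (C : ℝ) (hC : ∀ z, |k z| ≤ C) (hf : IsUnitValued f) :
    ∫ z, k z * avg S f z ∂iidLaw V = ∫ z, k z * f z ∂iidLaw V := by
  have hb : ∀ z, |k z * f z| ≤ C := by
    intro z
    have h1 := hf.nonneg z
    have h2 := hf.le_one z
    rw [abs_mul, abs_of_nonneg h1]
    nlinarith [hC z, abs_nonneg (k z)]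
  simp only [← avg_mul_of_dependsOn hk]
  exact integral_avg S (hkm.mul hf.measurable) C hb

theorem avg_sum {ι : Type*} [Fintype ι] (S : Set V) {f : ι → (V → unitInterval) → ℝ}
    (hf : ∀ i, IsUnitValued (f i)) (z : V → unitInterval) :
    avg S (fun z => ∑ i, f i z) z = ∑ i, avg S (f i) z := by
  simp only [avg]
  rw [integral_finsetSum _ fun i _ => ((hf i).comp_merge S z).integrable]

theorem integral_unitValued_avg (S : Set V) {f : (V → unitInterval) → ℝ} (hf : IsUnitValued f) :
    ∫ z, avg S f z ∂iidLaw V = ∫ z, f z ∂iidLaw V := by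
  have := integral_mul_avg (S := S) (k := fun _ => 1) (f := f) (fun _ _ _ => rfl)
    measurable_const 1 (by simp) hf
  simpa using this

theorem abs_mul_log_le_one {x : ℝ} (h0 : 0 ≤ x) (h1 : x ≤ 1) : |x * Real.log x| ≤ 1 := by
  rcases h0.eq_or_lt with rfl | h0
  · simp
  · rw [mul_comm]
    exact (Real.abs_log_mul_self_lt x h0 h1).le

/-- The convex function `x log x` lies above its tangent at `y`. -/
theorem mul_log_ge {p y : ℝ} (hp : 0 ≤ p) (hy : 0 < y) :
    p * Real.log y + p - y ≤ p * Real.log p := by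
  rcases hp.eq_or_lt with rfl | hp
  · simp [hy.le]
  · have h := Real.log_le_sub_one_of_pos (div_pos hy hp)
    rw [Real.log_div hy.ne' hp.ne'] at h
    have h2 := mul_le_mul_of_nonneg_left h hp.le
    have h3 : p * (y / p - 1) = y - p := by field_simp
    nlinarith

theorem mul_log_add_le {q ε : ℝ} (hq : 0 ≤ q) (hε : 0 < ε) :
    q * Real.log (q + ε) ≤ q * Real.log q + ε := by
  have := mul_log_ge hq (by linarith : 0 < q + ε)
  linarith

end Averaging

/-! ### Monotonicity of information gains -/

section Jensen

variable {V : Type*}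

theorem DependsOn.mono_set {f : (V → unitInterval) → ℝ} {S T : Set V} (hf : DependsOn f S)
    (h : S ⊆ T) : DependsOn f T := fun _ _ hxy => hf fun i hi => hxy i (h hi)

theorem integral_mul_avg_of_subset {S T : Set V} (hST : S ⊆ T) {k f : (V → unitInterval) → ℝ}
    (hk : DependsOn k S) (hkm : Measurable k) (C : ℝ) (hC : ∀ z, |k z| ≤ C)
    (hf : IsUnitValued f) :
    ∫ z, k z * avg T f z ∂iidLaw V = ∫ z, k z * avg S f z ∂iidLaw V := by
  rw [integral_mul_avg hk hkm C hC hf,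
    integral_mul_avg (DependsOn.mono_set hk hST) hkm C hC hf]

theorem abs_log_add_le {x δ : ℝ} (h0 : 0 ≤ x) (h1 : x ≤ 1) (hδ : 0 < δ) :
    |Real.log (x + δ)| ≤ max |Real.log δ| |Real.log (1 + δ)| :=
  abs_le_max_abs_abs (Real.log_le_log hδ (by linarith)) (Real.log_le_log (by linarith) (by linarith))

theorem mul_log_add_ge {q ε : ℝ} (hq : 0 ≤ q) (hε : 0 < ε) :
    q * Real.log q ≤ q * Real.log (q + ε) := by
  rcases hq.eq_or_lt with rfl | hq
  · simp
  · exact mul_le_mul_of_nonneg_left (Real.log_le_log hq (by linarith)) hq.le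

theorem IsUnitValued.integrable_mul_log {f : (V → unitInterval) → ℝ} (hf : IsUnitValued f) :
    Integrable (fun z => f z * Real.log (f z)) (iidLaw V) :=
  integrable_of_abs_le (hf.measurable.mul (Real.measurable_log.comp hf.measurable)) 1
    fun z => abs_mul_log_le_one (hf.nonneg z) (hf.le_one z)

theorem integrable_mul_unitValued {k f : (V → unitInterval) → ℝ}
    (hkm : Measurable k) (C : ℝ) (hC : ∀ z, |k z| ≤ C) (hf : IsUnitValued f) :
    Integrable (fun z => k z * f z) (iidLaw V) := by
  refine integrable_of_abs_le (hkm.mul hf.measurable) C fun z => ?_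
  have h1 := hf.nonneg z
  have h2 := hf.le_one z
  rw [abs_mul, abs_of_nonneg h1]
  nlinarith [hC z, abs_nonneg (k z)]

/-- Gibbs' inequality: bound `p i * log (p i)` below by its tangent at the test value `q i * p0 /
q0`, the fine conditional probability given `S` tilted by the coarse gain from `S ∩ U` to `U`. The
shifts by `ε` avoid division by zero and unbounded logarithms. -/
theorem integral_mul_log_sub_le_add {ι : Type*} [Fintype ι] {S T U : Set V} (hST : S ⊆ T)
    (hUT : U ⊆ T) {f : ι → (V → unitInterval) → ℝ} (hf : ∀ i, IsUnitValued (f i))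
    (hg : IsUnitValued fun z => ∑ i, f i z) {ε : ℝ} (hε : 0 < ε) (hε1 : ε ≤ 1) :
    (∫ z, avg U (fun z => ∑ i, f i z) z * Real.log (avg U (fun z => ∑ i, f i z) z) ∂iidLaw V) -
      ∫ z, avg (S ∩ U) (fun z => ∑ i, f i z) z *
        Real.log (avg (S ∩ U) (fun z => ∑ i, f i z) z) ∂iidLaw V ≤
    ∑ i, ((∫ z, avg T (f i) z * Real.log (avg T (f i) z) ∂iidLaw V) -
      ∫ z, avg S (f i) z * Real.log (avg S (f i) z) ∂iidLaw V) +
      (2 + 2 * Fintype.card ι) * ε := by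
  set g : (V → unitInterval) → ℝ := fun z => ∑ i, f i z with hgdef
  set n : ℝ := ((Fintype.card ι : ℕ) : ℝ) with hn
  set p := fun i => avg T (f i) with hpdef
  set q := fun i => avg S (f i) with hqdef
  set p0 := avg U g with hp0def
  set q0 := avg (S ∩ U) g with hq0def
  have hp : ∀ i, IsUnitValued (p i) := fun i => (hf i).avg T
  have hq : ∀ i, IsUnitValued (q i) := fun i => (hf i).avg S
  have hp0 : IsUnitValued p0 := hg.avg U
  have hq0 : IsUnitValued q0 := hg.avg _
  have hn0 : 0 ≤ n := Nat.cast_nonneg _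
  have hδ : 0 < ε ^ 2 := by positivity
  -- The shift is `ε ^ 2` because it gets multiplied by the ratio `c` below, which is bounded only
  -- by `(1 + ε) / ε`; the product is still of order `ε`.
  set lq : ι → (V → unitInterval) → ℝ := fun i z => Real.log (q i z + ε ^ 2) with hlq
  have hlqm : ∀ i, Measurable (lq i) := fun i =>
    Real.measurable_log.comp ((hq i).measurable.add_const _)
  have hlqb : ∀ i z, |lq i z| ≤ _ := fun i z =>
    abs_log_add_le ((hq i).nonneg z) ((hq i).le_one z) hδ
  have hlqd : ∀ i, DependsOn (lq i) S := fun i x y hxy => by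
    simp only [hlq, hqdef, dependsOn_avg S (f i) hxy]
  set lp0 : (V → unitInterval) → ℝ := fun z => Real.log (p0 z + ε) with hlp0
  have hlp0m : Measurable lp0 := Real.measurable_log.comp (hp0.measurable.add_const _)
  have hlp0b : ∀ z, |lp0 z| ≤ _ := fun z => abs_log_add_le (hp0.nonneg z) (hp0.le_one z) hε
  have hlp0d : DependsOn lp0 U := fun x y hxy => by
    simp only [hlp0, hp0def, dependsOn_avg U g hxy]
  set lq0 : (V → unitInterval) → ℝ := fun z => Real.log (q0 z + ε) with hlq0
  have hlq0m : Measurable lq0 := Real.measurable_log.comp (hq0.measurable.add_const _)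
  have hlq0b : ∀ z, |lq0 z| ≤ _ := fun z => abs_log_add_le (hq0.nonneg z) (hq0.le_one z) hε
  have hlq0d : DependsOn lq0 (S ∩ U) := fun x y hxy => by
    simp only [hlq0, hq0def, dependsOn_avg (S ∩ U) g hxy]
  set c : (V → unitInterval) → ℝ := fun z => (p0 z + ε) / (q0 z + ε) with hc
  have hcm : Measurable c := (hp0.measurable.add_const _).div (hq0.measurable.add_const _)
  have hcpos : ∀ z, 0 < c z := fun z =>
    div_pos (by linarith [hp0.nonneg z]) (by linarith [hq0.nonneg z])
  have hcle : ∀ z, c z ≤ (1 + ε) / ε := fun z =>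
    div_le_div₀ (by linarith) (by linarith [hp0.le_one z]) hε (by linarith [hq0.nonneg z])
  have hcb : ∀ z, |c z| ≤ (1 + ε) / ε := fun z => by rw [abs_of_pos (hcpos z)]; exact hcle z
  have hcd : DependsOn c U := fun x y hxy => by
    simp only [hc, hp0def, hq0def, dependsOn_avg U g hxy,
      DependsOn.mono_set (dependsOn_avg (S ∩ U) g) Set.inter_subset_right hxy]
  have hlogc : ∀ z, Real.log (c z) = lp0 z - lq0 z := fun z =>
    Real.log_div (by linarith [hp0.nonneg z]) (by linarith [hq0.nonneg z])
  have hpsum : ∀ z, ∑ i, p i z = avg T g z := fun z => (avg_sum T hf z).symm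
  have hqsum : ∀ z, ∑ i, q i z = avg S g z := fun z => (avg_sum S hf z).symm
  have hpt : ∀ z, ∑ i, lq i z * p i z + (lp0 z * avg T g z - lq0 z * avg T g z) + avg T g z -
      c z * avg S g z - n * ε ^ 2 * ((1 + ε) / ε) ≤ ∑ i, p i z * Real.log (p i z) := by
    intro z
    have h1 : ∀ i, lq i z * p i z + (lp0 z - lq0 z) * p i z + p i z - c z * q i z -
        ε ^ 2 * ((1 + ε) / ε) ≤ p i z * Real.log (p i z) := by
      intro i
      have hy : 0 < q i z + ε ^ 2 := by linarith [(hq i).nonneg z]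
      have h2 := mul_log_ge ((hp i).nonneg z) (mul_pos hy (hcpos z))
      rw [Real.log_mul hy.ne' (hcpos z).ne', hlogc] at h2
      have h3 : ε ^ 2 * c z ≤ ε ^ 2 * ((1 + ε) / ε) := mul_le_mul_of_nonneg_left (hcle z) hδ.le
      simp only [hlq]
      nlinarith
    have h2 := Finset.sum_le_sum fun i (_ : i ∈ Finset.univ) => h1 i
    simp only [Finset.sum_sub_distrib, Finset.sum_add_distrib, ← Finset.mul_sum, hpsum, hqsum,
      Finset.sum_const, Finset.card_univ, nsmul_eq_mul] at h2
    rw [← hn] at h2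
    linarith
  have hgT : IsUnitValued (avg T g) := hg.avg T
  have hgS : IsUnitValued (avg S g) := hg.avg S
  have i1 : ∀ i, Integrable (fun z => lq i z * p i z) (iidLaw V) := fun i =>
    integrable_mul_unitValued (hlqm i) _ (hlqb i) (hp i)
  have i2 := integrable_mul_unitValued hlp0m _ hlp0b hgT
  have i3 := integrable_mul_unitValued hlq0m _ hlq0b hgT
  have i4 := hgT.integrable
  have i5 := integrable_mul_unitValued hcm _ hcb hgS
  have i6 : Integrable (fun _ : V → unitInterval => n * ε ^ 2 * ((1 + ε) / ε)) (iidLaw V) :=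
    integrable_const _
  have j1 : Integrable (fun z => ∑ i, lq i z * p i z) (iidLaw V) :=
    integrable_finsetSum _ fun i _ => i1 i
  have j2 : Integrable (fun z => lp0 z * avg T g z - lq0 z * avg T g z) (iidLaw V) := i2.sub i3
  have j3 : Integrable (fun z => ∑ i, lq i z * p i z +
      (lp0 z * avg T g z - lq0 z * avg T g z)) (iidLaw V) := j1.add j2
  have j4 : Integrable (fun z => ∑ i, lq i z * p i z +
      (lp0 z * avg T g z - lq0 z * avg T g z) + avg T g z) (iidLaw V) := j3.add i4
  have j5 : Integrable (fun z => ∑ i, lq i z * p i z +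
      (lp0 z * avg T g z - lq0 z * avg T g z) + avg T g z - c z * avg S g z) (iidLaw V) :=
    j4.sub i5
  have hint := integral_mono (j5.sub i6)
    (integrable_finsetSum Finset.univ fun i _ => (hp i).integrable_mul_log) hpt
  have e0 : ∫ z, (∑ i, lq i z * p i z + (lp0 z * avg T g z - lq0 z * avg T g z) + avg T g z -
      c z * avg S g z - n * ε ^ 2 * ((1 + ε) / ε)) ∂iidLaw V =
      ∑ i, ∫ z, lq i z * p i z ∂iidLaw V + (∫ z, lp0 z * avg T g z ∂iidLaw V -
        ∫ z, lq0 z * avg T g z ∂iidLaw V) + ∫ z, avg T g z ∂iidLaw V -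
      ∫ z, c z * avg S g z ∂iidLaw V - n * ε ^ 2 * ((1 + ε) / ε) := by
    rw [integral_sub j5 i6, integral_sub j4 i5, integral_add j3 i4, integral_add j1 j2,
      integral_sub i2 i3, integral_finsetSum _ fun i _ => i1 i]
    simp
  have e1 : ∀ i, ∫ z, q i z * Real.log (q i z) ∂iidLaw V ≤ ∫ z, lq i z * p i z ∂iidLaw V := by
    intro i
    rw [integral_mul_avg_of_subset hST (hlqd i) (hlqm i) _ (hlqb i) (hf i)]
    refine integral_mono (hq i).integrable_mul_log
      (integrable_mul_unitValued (hlqm i) _ (hlqb i) (hq i)) fun z => ?_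
    have := mul_log_add_ge ((hq i).nonneg z) hδ
    simp only [hlq]
    linarith
  have e2 : ∫ z, p0 z * Real.log (p0 z) ∂iidLaw V ≤ ∫ z, lp0 z * avg T g z ∂iidLaw V := by
    rw [integral_mul_avg_of_subset hUT hlp0d hlp0m _ hlp0b hg]
    refine integral_mono hp0.integrable_mul_log
      (integrable_mul_unitValued hlp0m _ hlp0b hp0) fun z => ?_
    have := mul_log_add_ge (hp0.nonneg z) hε
    simp only [hlp0]
    linarith
  have e3 : ∫ z, lq0 z * avg T g z ∂iidLaw V ≤ ∫ z, q0 z * Real.log (q0 z) ∂iidLaw V + ε := by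
    rw [integral_mul_avg_of_subset (Set.inter_subset_left.trans hST) hlq0d hlq0m _ hlq0b hg]
    have : ∫ z, (q0 z * Real.log (q0 z) + ε) ∂iidLaw V =
        ∫ z, q0 z * Real.log (q0 z) ∂iidLaw V + ε := by
      rw [integral_add hq0.integrable_mul_log (integrable_const _)]
      simp
    rw [← this]
    refine integral_mono (integrable_mul_unitValued hlq0m _ hlq0b hq0)
      (hq0.integrable_mul_log.add (integrable_const _)) fun z => ?_
    have := mul_log_add_le (hq0.nonneg z) hε
    simp only [hlq0]
    linarith
  -- The tilted test values have almost the right total mass: `c` depends on `U` only, so `avg S g`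
  -- may be averaged to `avg U (avg S g) = q0`, and `c * q0 ≤ p0 + ε`.
  have e4 : ∫ z, c z * avg S g z ∂iidLaw V ≤ ∫ z, avg T g z ∂iidLaw V + ε := by
    rw [← integral_mul_avg hcd hcm _ hcb hgS, avg_avg U S hg, Set.inter_comm U S,
      integral_unitValued_avg T hg, ← integral_unitValued_avg U hg]
    have : ∫ z, (p0 z + ε) ∂iidLaw V = ∫ z, p0 z ∂iidLaw V + ε := by
      rw [integral_add hp0.integrable (integrable_const _)]
      simp
    rw [← this]
    refine integral_mono (integrable_mul_unitValued hcm _ hcb hq0)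
      (hp0.integrable.add (integrable_const _)) fun z => ?_
    have h1 := hq0.nonneg z
    have h2 := hp0.nonneg z
    have h3 : c z * (q0 z + ε) = p0 z + ε := div_mul_cancel₀ _ (by linarith)
    nlinarith [hcpos z]
  have e5 : n * ε ^ 2 * ((1 + ε) / ε) ≤ 2 * n * ε := by
    have : n * ε ^ 2 * ((1 + ε) / ε) = n * ε * (1 + ε) := by field_simp
    rw [this]
    nlinarith [mul_nonneg hn0 hε.le]
  have e6 := Finset.sum_le_sum fun i (_ : i ∈ Finset.univ) => e1 i
  have hint' := (e0.symm.le.trans hint)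
  rw [integral_finsetSum _ fun i _ => (hp i).integrable_mul_log] at hint'
  rw [Finset.sum_sub_distrib]
  linarith

/-- Joint convexity of relative entropy: information gains increase when the seeds on a larger
set are known, and when a variable is refined. -/
theorem integral_mul_log_sub_le {ι : Type*} [Fintype ι] {S T U : Set V} (hST : S ⊆ T)
    (hUT : U ⊆ T) {f : ι → (V → unitInterval) → ℝ} (hf : ∀ i, IsUnitValued (f i))
    (hg : IsUnitValued fun z => ∑ i, f i z) :
    (∫ z, avg U (fun z => ∑ i, f i z) z * Real.log (avg U (fun z => ∑ i, f i z) z) ∂iidLaw V) -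
      ∫ z, avg (S ∩ U) (fun z => ∑ i, f i z) z *
        Real.log (avg (S ∩ U) (fun z => ∑ i, f i z) z) ∂iidLaw V ≤
    ∑ i, ((∫ z, avg T (f i) z * Real.log (avg T (f i) z) ∂iidLaw V) -
      ∫ z, avg S (f i) z * Real.log (avg S (f i) z) ∂iidLaw V) := by
  refine le_of_forall_pos_le_add fun η hη => ?_
  have hn : (0 : ℝ) < 2 + 2 * Fintype.card ι := by positivity
  have hε : 0 < min 1 (η / (2 + 2 * Fintype.card ι)) := lt_min one_pos (by positivity)
  refine (integral_mul_log_sub_le_add hST hUT hf hg hε (min_le_left _ _)).trans ?_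
  have : (2 + 2 * (Fintype.card ι : ℝ)) * min 1 (η / (2 + 2 * Fintype.card ι)) ≤ η := by
    calc _ ≤ (2 + 2 * (Fintype.card ι : ℝ)) * (η / (2 + 2 * Fintype.card ι)) :=
          mul_le_mul_of_nonneg_left (min_le_right _ _) hn.le
      _ = η := by field_simp
  linarith

end Jensen

/-! ### Mutual information with sets of seeds -/

section Information

variable {V : Type*} {M : Type*}

open Classical in
/-- The indicator of the event `Y = m`. -/
noncomputable def valueIndicator (Y : (V → unitInterval) → M) (m : M) (z : V → unitInterval) : ℝ :=
  if Y z = m then 1 else 0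

theorem isUnitValued_valueIndicator [MeasurableSpace M] [MeasurableSingletonClass M]
    {Y : (V → unitInterval) → M} (hY : Measurable Y) (m : M) :
    IsUnitValued (valueIndicator Y m) where
  measurable := Measurable.ite (hY (measurableSet_singleton m)) measurable_const measurable_const
  nonneg z := by unfold valueIndicator; split_ifs <;> norm_num
  le_one z := by unfold valueIndicator; split_ifs <;> norm_num

theorem integral_valueIndicator [MeasurableSpace M] [MeasurableSingletonClass M]
    {Y : (V → unitInterval) → M} (hY : Measurable Y) (m : M) :
    ∫ z, valueIndicator Y m z ∂iidLaw V = (iidLaw V).real (Y ⁻¹' {m}) := by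
  classical
  have : valueIndicator Y m = (Y ⁻¹' {m}).indicator 1 := by
    funext z
    simp [valueIndicator, Set.indicator_apply]
  rw [this, integral_indicator_one (hY (measurableSet_singleton m))]

/-- The mutual information of `Y` and the seeds on `S`. -/
noncomputable def info [Fintype M] (Y : (V → unitInterval) → M) (S : Set V) : ℝ :=
  entropy (iidLaw V) Y + ∑ m, ∫ z, avg S (valueIndicator Y m) z *
    Real.log (avg S (valueIndicator Y m) z) ∂iidLaw V

variable [Fintype M] [MeasurableSpace M] [MeasurableSingletonClass M]

theorem info_empty {Y : (V → unitInterval) → M} (hY : Measurable Y) : info Y ∅ = 0 := by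
  have h : ∀ m z, avg ∅ (valueIndicator Y m) z = (iidLaw V).real (Y ⁻¹' {m}) := by
    intro m z
    rw [← integral_valueIndicator hY, avg]
    congr 1
    funext w
    congr 1
    funext v
    exact merge_of_notMem (Set.notMem_empty v) z w
  simp [info, h, entropy, Real.negMulLog]

theorem info_le_entropy {Y : (V → unitInterval) → M} (hY : Measurable Y) (S : Set V) :
    info Y S ≤ entropy (iidLaw V) Y := by
  have : ∑ m, ∫ z, avg S (valueIndicator Y m) z *
      Real.log (avg S (valueIndicator Y m) z) ∂iidLaw V ≤ 0 := by
    refine Finset.sum_nonpos fun m _ => integral_nonpos fun z => ?_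
    have := (isUnitValued_valueIndicator hY m).avg S
    exact Real.mul_log_nonpos (this.nonneg z) (this.le_one z)
  unfold info
  linarith

theorem info_sub_le {N : Type*} [Fintype N] [MeasurableSpace N] [MeasurableSingletonClass N]
    {Y : (V → unitInterval) → M} (hY : Measurable Y) (π : M → N)
    (hπ : Measurable fun z => π (Y z)) {S T U : Set V} (hST : S ⊆ T) (hUT : U ⊆ T) :
    info (fun z => π (Y z)) U - info (fun z => π (Y z)) (S ∩ U) ≤ info Y T - info Y S := by
  classical
  -- The event `π (Y z) = n` splits into the events `Y z = m` over the fiber of `n`, so the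
  -- inequality is applied fiber by fiber.
  have key : ∀ n : N, _ := fun n =>
    have hs : (fun z => ∑ i : {m // π m = n}, valueIndicator Y i.1 z) =
        valueIndicator (fun z => π (Y z)) n := by
      funext z
      by_cases h : π (Y z) = n
      · rw [Finset.sum_eq_single ⟨Y z, h⟩]
        · simp [valueIndicator, h]
        · rintro ⟨b, hb⟩ _ hne
          simp only [valueIndicator, ite_eq_right_iff, one_ne_zero, imp_false]
          rintro rfl
          exact hne rfl
        · simp
      · simp only [valueIndicator, h, if_false]
        refine Finset.sum_eq_zero fun i _ => ?_
        rw [if_neg]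
        rintro hi
        exact h (hi ▸ i.2)
    hs ▸ integral_mul_log_sub_le hST hUT (ι := {m // π m = n}) (f := fun i => valueIndicator Y i.1)
      (fun i => isUnitValued_valueIndicator hY i.1) (by
        rw [hs]; exact isUnitValued_valueIndicator hπ n)
  have h1 := Finset.sum_le_sum fun n (_ : n ∈ Finset.univ) => key n
  rw [Fintype.sum_fiberwise π (fun m => (∫ z, avg T (valueIndicator Y m) z *
      Real.log (avg T (valueIndicator Y m) z) ∂iidLaw V) - ∫ z, avg S (valueIndicator Y m) z *
      Real.log (avg S (valueIndicator Y m) z) ∂iidLaw V)] at h1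
  simp only [Finset.sum_sub_distrib] at h1
  unfold info
  linarith

theorem info_mono {Y : (V → unitInterval) → M} (hY : Measurable Y) {S T : Set V} (hST : S ⊆ T) :
    info Y S ≤ info Y T := by
  -- With `U = ∅` there is no gain on the left side.
  have := info_sub_le hY id hY hST (Set.empty_subset T)
  simp only [id, Set.inter_empty, sub_self] at this
  linarith

theorem measurePreserving_comp_equiv (φ : V ≃ V) :
    MeasurePreserving (fun z : V → unitInterval => z ∘ φ) (iidLaw V) (iidLaw V) := by
  have hm : Measurable fun z : V → unitInterval => z ∘ φ := by
    refine measurable_pi_lambda _ fun v => ?_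
    exact measurable_pi_apply (φ v)
  refine ⟨hm, ?_⟩
  refine Measure.eq_infinitePi _ fun s t ht => ?_
  rw [Measure.map_apply hm (.pi s.countable_toSet fun i hi => ht i)]
  have hpre : (fun z : V → unitInterval => z ∘ φ) ⁻¹' (Set.pi s t) =
      Set.pi (s.map φ.toEmbedding : Finset V) (fun v => t (φ.symm v)) := by
    ext z
    simp only [Set.mem_preimage, Set.mem_pi, Finset.mem_coe, Finset.mem_map_equiv,
      Function.comp_apply]
    exact ⟨fun h i hi => by simpa using h _ hi, fun h i hi => by simpa using h (φ i) (by simpa)⟩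
  rw [hpre, iidLaw, Measure.infinitePi_pi _ fun i _ => ht _, Finset.prod_map]
  simp

theorem integral_comp_equiv (φ : V ≃ V) {f : (V → unitInterval) → ℝ} (hf : Measurable f) :
    ∫ z, f (z ∘ φ) ∂iidLaw V = ∫ z, f z ∂iidLaw V := by
  have h := measurePreserving_comp_equiv φ
  rw [← h.map_eq, integral_map h.measurable.aemeasurable hf.aestronglyMeasurable, h.map_eq]

theorem avg_comp_equiv (φ : V ≃ V) (S : Set V) {f : (V → unitInterval) → ℝ} (hf : Measurable f)
    (z : V → unitInterval) :
    avg (φ '' S) (fun z => f (z ∘ φ)) z = avg S f (z ∘ φ) := by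
  have h : ∀ w, merge (φ '' S) z w ∘ φ = merge S (z ∘ φ) (w ∘ φ) := by
    intro w
    funext v
    by_cases hv : v ∈ S <;> simp [merge, hv]
  simp only [avg, h]
  exact integral_comp_equiv φ (f := fun w => f (merge S (z ∘ φ) w))
    (hf.comp (measurable_merge_right S _))

theorem entropy_comp_equiv (φ : V ≃ V) {Y : (V → unitInterval) → M} (hY : Measurable Y) :
    entropy (iidLaw V) (fun z => Y (z ∘ φ)) = entropy (iidLaw V) Y := by
  unfold entropy
  refine Finset.sum_congr rfl fun m _ => ?_
  congr 1
  exact congrArg ENNReal.toReal ((measurePreserving_comp_equiv φ).measure_preimage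
    (hY (measurableSet_singleton m)).nullMeasurableSet)

theorem info_comp_equiv (φ : V ≃ V) {Y : (V → unitInterval) → M} (hY : Measurable Y)
    (S : Set V) : info (fun z => Y (z ∘ φ)) (φ '' S) = info Y S := by
  unfold info
  rw [entropy_comp_equiv φ hY]
  congr 1
  refine Finset.sum_congr rfl fun m _ => ?_
  have hi := isUnitValued_valueIndicator hY m
  have h : ∀ z, avg (φ '' S) (valueIndicator (fun z => Y (z ∘ φ)) m) z =
      avg S (valueIndicator Y m) (z ∘ φ) := avg_comp_equiv φ S hi.measurable
  simp only [h]
  exact integral_comp_equiv φ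
    (f := fun z => avg S (valueIndicator Y m) z * Real.log (avg S (valueIndicator Y m) z))
    ((hi.avg S).measurable.mul (Real.measurable_log.comp (hi.avg S).measurable))

/-- The σ-algebra generated by the seeds on `S`. -/
noncomputable abbrev seedSigma (S : Set V) : MeasurableSpace (V → unitInterval) :=
  MeasurableSpace.comap (fun z => merge S z 0) inferInstance

theorem merge_zero_merge_zero {S T : Set V} (h : S ⊆ T) (z : V → unitInterval) :
    merge S (merge T z 0) 0 = merge S z 0 := by
  funext v
  by_cases hv : v ∈ S
  · simp [merge, hv, h hv]
  · simp [merge, hv]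

theorem measurable_merge_zero (S : Set V) : Measurable fun z : V → unitInterval => merge S z 0 :=
  (measurable_merge S).comp measurable_prodMk_right

theorem seedSigma_mono {S T : Set V} (h : S ⊆ T) : seedSigma S ≤ seedSigma T := by
  rintro _ ⟨t, ht, rfl⟩
  refine ⟨(fun z => merge S z 0) ⁻¹' t, measurable_merge_zero S ht, ?_⟩
  ext z
  simp only [Set.mem_preimage, merge_zero_merge_zero h]

theorem seedSigma_le (S : Set V) : seedSigma S ≤ MeasurableSpace.pi :=
  (measurable_merge_zero S).comap_le

/-- Identifies the explicit averages with conditional expectations, so that Lévy's upward theorem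
applies to them. -/
theorem avg_ae_eq_condExp (S : Set V) {f : (V → unitInterval) → ℝ} (hf : IsUnitValued f) :
    avg S f =ᵐ[iidLaw V] (iidLaw V)[f | seedSigma S] := by
  classical
  have hd : ∀ z, avg S f (merge S z 0) = avg S f z := fun z =>
    dependsOn_avg S f fun i hi => merge_of_mem hi z 0
  refine ae_eq_condExp_of_forall_setIntegral_eq (seedSigma_le S) hf.integrable
    (fun s _ _ => (hf.avg S).integrable.integrableOn) ?_ ?_
  · rintro _ ⟨t, ht, rfl⟩ -
    have hs := measurable_merge_zero S ht
    rw [← integral_indicator hs, ← integral_indicator hs]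
    set k : (V → unitInterval) → ℝ := ((fun z => merge S z 0) ⁻¹' t).indicator 1 with hk
    have hi : ∀ g : (V → unitInterval) → ℝ,
        ((fun z => merge S z 0) ⁻¹' t).indicator g = fun z => k z * g z := by
      intro g
      funext z
      by_cases hz : z ∈ (fun z => merge S z 0) ⁻¹' t <;> simp [hk, hz]
    rw [hi, hi]
    refine integral_mul_avg (fun x y hxy => ?_) (measurable_one.indicator hs) 1 (fun z => ?_) hf
    · have : merge S x 0 = merge S y 0 := by
        funext v
        by_cases hv : v ∈ S
        · simp [merge, hv, hxy v hv]
        · simp [merge, hv]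
      simp [hk, Set.indicator_apply, this]
    · simp only [hk, Set.indicator_apply]
      split_ifs <;> simp
  · have h : Measurable[seedSigma S] (avg S f) := by
      have : avg S f = avg S f ∘ fun z => merge S z 0 := funext fun z => (hd z).symm
      rw [this]
      exact (hf.avg S).measurable.comp (comap_measurable _)
    exact h.stronglyMeasurable.aestronglyMeasurable

theorem ae_tendsto_avg {B : ℕ → Set V} (hB : Monotone B) (hU : ∀ v, ∃ n, v ∈ B n)
    {f : (V → unitInterval) → ℝ} (hf : IsUnitValued f) :
    ∀ᵐ z ∂iidLaw V, Filter.Tendsto (fun n => avg (B n) f z) Filter.atTop (nhds (f z)) := by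
  let ℱ : Filtration ℕ (MeasurableSpace.pi : MeasurableSpace (V → unitInterval)) :=
    ⟨fun n => seedSigma (B n), fun m n h => seedSigma_mono (hB h), fun n => seedSigma_le _⟩
  have hsup : MeasurableSpace.pi ≤ ⨆ n, ℱ n := by
    refine iSup_le fun v => ?_
    obtain ⟨n, hn⟩ := hU v
    refine le_trans ?_ (le_iSup _ n)
    rintro _ ⟨t, ht, rfl⟩
    refine ⟨(fun z => z v) ⁻¹' t, measurable_pi_apply v ht, ?_⟩
    ext z
    simp only [Set.mem_preimage, merge_of_mem hn]
  have h1 := hf.integrable.tendsto_ae_condExp (ℱ := ℱ)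
    (hf.measurable.mono hsup le_rfl).stronglyMeasurable
  have h2 : ∀ᵐ z ∂iidLaw V, ∀ n, avg (B n) f z = ((iidLaw V)[f | ℱ n]) z :=
    ae_all_iff.2 fun n => avg_ae_eq_condExp (B n) hf
  filter_upwards [h1, h2] with z hz1 hz2
  simpa only [hz2] using hz1

/-- The information carried by increasing sets of seeds converges to the entropy. -/
theorem tendsto_info {B : ℕ → Set V} (hB : Monotone B) (hU : ∀ v, ∃ n, v ∈ B n)
    {Y : (V → unitInterval) → M} (hY : Measurable Y) :
    Filter.Tendsto (fun n => info Y (B n)) Filter.atTop (nhds (entropy (iidLaw V) Y)) := by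
  have h : ∀ m, Filter.Tendsto (fun n => ∫ z, avg (B n) (valueIndicator Y m) z *
      Real.log (avg (B n) (valueIndicator Y m) z) ∂iidLaw V) Filter.atTop (nhds 0) := by
    intro m
    have hi := isUnitValued_valueIndicator hY m
    have h0 : ∫ z, valueIndicator Y m z * Real.log (valueIndicator Y m z) ∂iidLaw V = 0 := by
      rw [← integral_zero (V → unitInterval) ℝ]
      congr 1
      funext z
      unfold valueIndicator
      split_ifs <;> simp
    rw [← h0]
    refine tendsto_integral_of_dominated_convergence (fun _ => 1)
      (fun n => (hi.avg (B n)).integrable_mul_log.aestronglyMeasurable) (integrable_const _)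
      (fun n => .of_forall fun z => ?_) ?_
    · exact abs_mul_log_le_one ((hi.avg (B n)).nonneg z) ((hi.avg (B n)).le_one z)
    · filter_upwards [ae_tendsto_avg hB hU hi] with z hz
      exact (Real.continuous_mul_log.tendsto _).comp hz
  have := (tendsto_const_nhds (x := entropy (iidLaw V) Y)).add
    (tendsto_finsetSum Finset.univ fun m _ => h m)
  simpa [info] using this

end Information

/-! ### Cheeger inequality for functions -/

section Isoperimetry

variable {V : Type*} (G : SimpleGraph V)

theorem cheegerConstant_nonneg : 0 ≤ cheegerConstant G :=
  Real.iInf_nonneg fun _ => by positivity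

theorem cheegerConstant_mul_card_le (W : Finset V) :
    cheegerConstant G * W.card ≤ (edgeBoundary G W).ncard := by
  rcases W.eq_empty_or_nonempty with rfl | hW
  · simp
  have hb : BddBelow (Set.range fun W : {W : Finset V // W.Nonempty} =>
      ((edgeBoundary G W.1).ncard : ℝ) / (W.1.card : ℝ)) :=
    ⟨0, by rintro _ ⟨W, rfl⟩; positivity⟩
  have h := ciInf_le hb ⟨W, hW⟩
  have hc : (0 : ℝ) < W.card := by exact_mod_cast hW.card_pos
  exact (le_div_iff₀ hc).1 h

variable [G.LocallyFinite]

-- A boundary edge has exactly one endpoint in `W`, so summing outward neighbors over `W` counts it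
-- once.
open Classical in
theorem ncard_edgeBoundary (W : Finset V) :
    (edgeBoundary G W).ncard = ∑ v ∈ W, ((G.neighborFinset v).filter (· ∉ W)).card := by
  have h : edgeBoundary G W =
      ↑((W.sigma fun v => (G.neighborFinset v).filter (· ∉ W)).image fun p => s(p.1, p.2)) := by
    ext e
    simp only [edgeBoundary, Set.mem_ofPred_eq, Finset.coe_image, Set.mem_image, Finset.mem_coe,
      Finset.mem_sigma, Finset.mem_filter, SimpleGraph.mem_neighborFinset, Sigma.exists]
    constructor
    · rintro ⟨he, u, hu, v, hv, rfl⟩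
      exact ⟨u, v, ⟨hu, he, hv⟩, rfl⟩
    · rintro ⟨u, v, ⟨hu, he, hv⟩, rfl⟩
      exact ⟨he, u, hu, v, hv, rfl⟩
  rw [h, Set.ncard_coe_finset, Finset.card_image_of_injOn, Finset.card_sigma]
  rintro ⟨a, b⟩ hab ⟨a', b'⟩ hab' heq
  simp only [Finset.mem_coe, Finset.mem_sigma, Finset.mem_filter] at hab hab'
  rcases Sym2.eq_iff.1 heq with ⟨h1, h2⟩ | ⟨h1, h2⟩
  · simp only at h1 h2
    subst h1 h2
    rfl
  · simp only at h1 h2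
    subst h1 h2
    exact absurd hab'.1 hab.2.2

-- Layer-cake argument: peel off the lowest positive level `t` of `g`. The layer has mass `t * |W|`
-- and drop `t * |∂W|`, and the remaining function has smaller support. Subtraction in `ℝ≥0` is
-- truncated, so only drops count.
open Classical in
theorem mul_sum_le_sum_tsub {c : ℝ≥0}
    (hc : ∀ W : Finset V, c * W.card ≤ ∑ v ∈ W, ((G.neighborFinset v).filter (· ∉ W)).card)
    (W : Finset V) (g : V → ℝ≥0) (hW : ∀ v, v ∈ W ↔ g v ≠ 0) :
    c * ∑ v ∈ W, g v ≤ ∑ v ∈ W, ∑ v' ∈ G.neighborFinset v, (g v - g v') := by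
  induction W using Finset.strongInduction generalizing g with
  | H W ih =>
    rcases W.eq_empty_or_nonempty with rfl | hne
    · simp
    obtain ⟨v₀, hv₀, hmin⟩ := Finset.exists_min_image W g hne
    set t := g v₀ with ht
    set g' : V → ℝ≥0 := fun v => g v - t with hg'
    set W' := W.filter fun v => g' v ≠ 0 with hW'
    have hg0 : ∀ v, v ∉ W → g v = 0 := fun v hv => by
      by_contra h
      exact hv ((hW v).2 h)
    have hg'0 : ∀ v, v ∉ W → g' v = 0 := fun v hv => by simp [hg', hg0 v hv]
    have hgt : ∀ v ∈ W, g v = g' v + t := fun v hv => (tsub_add_cancel_of_le (hmin v hv)).symm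
    have hss : W' ⊂ W := by
      refine Finset.filter_ssubset.2 ⟨v₀, hv₀, ?_⟩
      simp [hg', ht]
    have h1 := ih W' hss g' fun v => by
      simp only [hW', Finset.mem_filter, and_iff_right_iff_imp]
      intro h
      by_contra hv
      exact h (hg'0 v hv)
    have h2 : ∑ v ∈ W', g' v = ∑ v ∈ W, g' v :=
      Finset.sum_filter_of_ne fun v _ h => h
    have h3 : ∑ v ∈ W', ∑ v' ∈ G.neighborFinset v, (g' v - g' v') =
        ∑ v ∈ W, ∑ v' ∈ G.neighborFinset v, (g' v - g' v') := by
      refine Finset.sum_filter_of_ne fun v _ h h0 => h ?_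
      simp [h0]
    have h4 : ∀ v ∈ W, ∑ v' ∈ G.neighborFinset v, (g v - g v') =
        ∑ v' ∈ G.neighborFinset v, (g' v - g' v') +
          ((G.neighborFinset v).filter (· ∉ W)).card * t := by
      intro v hv
      rw [← nsmul_eq_mul, ← Finset.sum_const, Finset.sum_filter, ← Finset.sum_add_distrib]
      refine Finset.sum_congr rfl fun v' _ => ?_
      by_cases hv' : v' ∈ W
      · rw [if_neg (not_not.2 hv'), hgt v hv, hgt v' hv', add_tsub_add_eq_tsub_right, add_zero]
      · rw [if_pos hv', hg0 v' hv', hg'0 v' hv', tsub_zero, tsub_zero, hgt v hv]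
    rw [h2, h3] at h1
    rw [Finset.sum_congr rfl hgt, Finset.sum_congr rfl h4, Finset.sum_add_distrib,
      Finset.sum_add_distrib, Finset.sum_const, nsmul_eq_mul, mul_add, ← Finset.sum_mul,
      ← mul_assoc]
    refine add_le_add h1 (mul_le_mul_left ?_ t)
    exact_mod_cast hc W

theorem mul_tsum_le_tsum_tsub (g : V → ℝ≥0) (hg : (Function.support g).Finite) :
    ENNReal.ofReal (cheegerConstant G) * ∑' v, (g v : ℝ≥0∞) ≤
      ∑' v, ∑ v' ∈ G.neighborFinset v, ((g v - g v' : ℝ≥0) : ℝ≥0∞) := by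
  classical
  have hW : ∀ v, v ∈ hg.toFinset ↔ g v ≠ 0 := fun v => by simp
  have hc : ∀ W : Finset V, (cheegerConstant G).toNNReal * W.card ≤
      ((∑ v ∈ W, ((G.neighborFinset v).filter (· ∉ W)).card : ℕ) : ℝ≥0) := by
    intro W
    rw [← NNReal.coe_le_coe]
    have := cheegerConstant_mul_card_le G W
    rw [ncard_edgeBoundary] at this
    simpa [Real.coe_toNNReal _ (cheegerConstant_nonneg G)] using this
  have h := mul_sum_le_sum_tsub G (c := (cheegerConstant G).toNNReal)
    (fun W => by exact_mod_cast hc W) hg.toFinset g hW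
  rw [tsum_eq_sum (s := hg.toFinset) fun v hv => by simpa using hv,
    tsum_eq_sum (s := hg.toFinset) fun v hv => by
      have : g v = 0 := by simpa using hv
      simp [this], ENNReal.ofReal]
  exact_mod_cast h

end Isoperimetry

/-! ### Finite balls in the graph distance -/

section Balls

variable {V : Type*} {G : SimpleGraph V}

theorem exists_adj_dist_add_one (hconn : G.Connected) {u v : V} (h : v ≠ u) :
    ∃ w, G.Adj v w ∧ G.dist u w + 1 = G.dist u v := by
  obtain ⟨p, hp⟩ := hconn.exists_walk_length_eq_dist v u
  cases p with
  | nil => exact absurd rfl h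
  | @cons _ w _ hvw q =>
    refine ⟨w, hvw, ?_⟩
    have h1 := SimpleGraph.dist_le q
    have h2 : G.dist v u ≤ G.dist v w + G.dist w u := hconn.dist_triangle
    rw [SimpleGraph.dist_eq_one_iff_adj.2 hvw] at h2
    rw [SimpleGraph.Walk.length_cons] at hp
    rw [SimpleGraph.dist_comm (u := u) (v := w), SimpleGraph.dist_comm (u := u) (v := v)]
    omega

theorem dist_map_iso (hconn : G.Connected) (φ : G ≃g G) (u v : V) :
    G.dist (φ u) (φ v) = G.dist u v := by
  have h : ∀ (ψ : G ≃g G) (u v : V), G.dist (ψ u) (ψ v) ≤ G.dist u v := by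
    intro ψ u v
    obtain ⟨p, hp⟩ := hconn.exists_walk_length_eq_dist u v
    rw [← hp, ← SimpleGraph.Walk.length_map ψ.toHom p]
    exact SimpleGraph.dist_le _
  refine le_antisymm (h φ u v) ?_
  simpa using h φ.symm (φ u) (φ v)

theorem finite_setOf_dist_le [G.LocallyFinite] (hconn : G.Connected) (r : ℕ) (v : V) :
    {w | G.dist v w ≤ r}.Finite := by
  induction r with
  | zero =>
    refine (Set.finite_singleton v).subset fun w hw => ?_
    exact (hconn.dist_eq_zero_iff.1 (Nat.le_zero.1 hw)).symm
  | succ r ih =>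
    refine (ih.union (ih.biUnion fun x _ => (G.neighborFinset x).finite_toSet)).subset
      fun w hw => ?_
    by_cases hwv : w = v
    · subst hwv
      left
      simp
    · obtain ⟨x, hwx, hx⟩ := exists_adj_dist_add_one hconn hwv
      right
      simp only [Set.mem_ofPred_eq] at hw
      simp only [Set.mem_iUnion, Finset.mem_coe, SimpleGraph.mem_neighborFinset]
      exact ⟨x, by simp only [Set.mem_ofPred_eq]; omega, hwx.symm⟩

/-- The closed ball of radius `r` in the graph distance. -/
noncomputable def seedBall [G.LocallyFinite] (hconn : G.Connected) (r : ℕ) (v : V) : Finset V :=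
  (finite_setOf_dist_le hconn r v).toFinset

variable [G.LocallyFinite] (hconn : G.Connected)

theorem mem_seedBall {r : ℕ} {v w : V} : w ∈ seedBall hconn r v ↔ G.dist v w ≤ r := by
  exact Set.Finite.mem_toFinset _

theorem map_seedBall (φ : G ≃g G) (r : ℕ) (v : V) :
    (seedBall hconn r v).map φ.toEquiv.toEmbedding = seedBall hconn r (φ v) := by
  ext w
  have h : φ (φ.toEquiv.symm w) = w := φ.toEquiv.apply_symm_apply w
  rw [Finset.mem_map_equiv, mem_seedBall, mem_seedBall, ← dist_map_iso hconn φ, h]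

end Balls

/-! ### Shapley shares of the seeds and mass transport -/

section Contribution

variable {V M : Type*} {G : SimpleGraph V} {F : (V → unitInterval) → (V → M)}

theorem measurable_label [MeasurableSpace M] (hF : Measurable F) (v : V) :
    Measurable fun z => F z v :=
  (measurable_pi_apply v).comp hF

variable [Fintype M]

/-- The Shapley share of the seed `j` in the information on the label of `v` carried by the seeds
within distance `r` from `v`. -/
noncomputable def contribution [G.LocallyFinite] (hconn : G.Connected)
    (F : (V → unitInterval) → (V → M)) (r : ℕ) (j v : V) : ℝ :=
  shapley (fun S : Finset V => info (fun z => F z v) (↑S ∩ ↑(seedBall hconn r v))) j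
    (seedBall hconn r v)

theorem contribution_of_notMem [G.LocallyFinite] (hconn : G.Connected) {r : ℕ} {j v : V}
    (h : j ∉ seedBall hconn r v) : contribution hconn F r j v = 0 :=
  shapley_of_notMem _ h

variable [MeasurableSpace M] [MeasurableSingletonClass M]

theorem info_map_iso (hF : Measurable F) (hequiv : IsEquivariant G F) (φ : G ≃g G) (v : V)
    (S : Set V) : info (fun z => F z (φ v)) (φ '' S) = info (fun z => F z v) S := by
  have h := info_comp_equiv φ.toEquiv (measurable_label hF v) S
  rw [← h]
  congr 1
  funext z
  exact (congrFun (hequiv φ z) v).symm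

theorem entropy_map_iso (hF : Measurable F) (hequiv : IsEquivariant G F) (φ : G ≃g G) (u v : V) :
    entropy (iidLaw V) (fun z => (F z (φ u), F z (φ v))) =
      entropy (iidLaw V) (fun z => (F z u, F z v)) := by
  rw [← entropy_comp_equiv φ.toEquiv ((measurable_label hF u).prodMk (measurable_label hF v))]
  congr 1
  funext z
  exact Prod.ext (congrFun (hequiv φ z) u).symm (congrFun (hequiv φ z) v).symm

variable [G.LocallyFinite] (hconn : G.Connected)

theorem contribution_nonneg (hF : Measurable F) (r : ℕ) (j v : V) :
    0 ≤ contribution hconn F r j v := by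
  classical
  refine shapley_nonneg _ fun S _ => info_mono (measurable_label hF v) ?_
  exact Set.inter_subset_inter_left _ (by simp)

theorem sum_contribution (hF : Measurable F) (r : ℕ) (v : V) :
    ∑ j ∈ seedBall hconn r v, contribution hconn F r j v =
      info (fun z => F z v) (seedBall hconn r v) := by
  simp only [contribution]
  rw [sum_shapley]
  simp [info_empty (measurable_label hF v)]

/-- Seeds outside the ball of `v` are dummies for the game of `v`, so both games may be played on
`B`. Each marginal is then compared by `info_sub_le`, with `T = insert j S` and `U` the part of `T`
in the ball. -/
theorem contribution_le_shapley {N : Type*} [Fintype N] [MeasurableSpace N]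
    [MeasurableSingletonClass N] {Y : (V → unitInterval) → N} (hY : Measurable Y) (π : N → M)
    (hF : Measurable F) {v : V} (hπ : ∀ z, π (Y z) = F z v) {r : ℕ} {B : Finset V}
    (hB : seedBall hconn r v ⊆ B) (j : V) :
    contribution hconn F r j v ≤ shapley (fun S : Finset V => info Y S) j B := by
  classical
  have h1 : contribution hconn F r j v = shapley (fun S : Finset V =>
      info (fun z => F z v) (↑S ∩ ↑(seedBall hconn r v))) j B := by
    rw [shapley_inter B (D := seedBall hconn r v) (fun S => by simp [Set.inter_assoc]),
      Finset.inter_eq_right.2 hB]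
    rfl
  rw [h1]
  refine shapley_mono _ fun S hj => ?_
  have hπ' : (fun z => π (Y z)) = fun z => F z v := funext hπ
  have hST : (S : Set V) ⊆ (insert j S : Finset V) := by simp
  have h2 := info_sub_le hY π (hπ' ▸ measurable_label hF v) hST
    (Set.inter_subset_left (s := ((insert j S : Finset V) : Set V)) (t := seedBall hconn r v))
  rwa [hπ', ← Set.inter_assoc, Set.inter_eq_left.2 hST] at h2

theorem info_seedBall_map_iso (hF : Measurable F) (hequiv : IsEquivariant G F) (φ : G ≃g G)
    (r : ℕ) (v : V) :
    info (fun z => F z (φ v)) (seedBall hconn r (φ v)) =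
      info (fun z => F z v) (seedBall hconn r v) := by
  rw [← info_map_iso hF hequiv φ v, ← map_seedBall, Finset.coe_map]
  rfl

theorem contribution_map_iso (hF : Measurable F) (hequiv : IsEquivariant G F) (φ : G ≃g G)
    (r : ℕ) (j v : V) :
    contribution hconn F r (φ j) (φ v) = contribution hconn F r j v := by
  have h := shapley_map (seedBall hconn r v) φ.toEquiv.toEmbedding
    (fun S : Finset V => info (fun z => F z (φ v)) (↑S ∩ ↑(seedBall hconn r (φ v)))) j
  rw [map_seedBall] at h
  refine h.trans ?_
  unfold contribution
  congr 1
  funext S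
  rw [← info_map_iso hF hequiv φ v, ← map_seedBall, Finset.coe_map, Finset.coe_map,
    Set.image_inter φ.injective]
  rfl

theorem coe_toNNReal_contribution (hF : Measurable F) (r : ℕ) (j v : V) :
    ((contribution hconn F r j v).toNNReal : ℝ) = contribution hconn F r j v :=
  Real.coe_toNNReal _ (contribution_nonneg hconn hF r j v)

theorem tsum_contribution (hF : Measurable F) (r : ℕ) (v : V) :
    ∑' j, ((contribution hconn F r j v).toNNReal : ℝ≥0∞) =
      ENNReal.ofReal (info (fun z => F z v) (seedBall hconn r v)) := by
  rw [tsum_eq_sum (s := seedBall hconn r v) fun j hj => by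
    simp [contribution_of_notMem hconn hj], ← sum_contribution hconn hF,
    ENNReal.ofReal_sum_of_nonneg fun j _ => contribution_nonneg hconn hF r j v]
  rfl

/-- Both shares are dominated by the share in the game of the pair, and those shares sum to an
information, hence to at most the pair entropy. -/
theorem tsum_max_contribution_le (hF : Measurable F) (r : ℕ) (u v : V) :
    ∑' j, ((max (contribution hconn F r j u).toNNReal (contribution hconn F r j v).toNNReal :
      ℝ≥0) : ℝ≥0∞) ≤ ENNReal.ofReal (entropy (iidLaw V) (fun z => (F z u, F z v))) := by
  classical
  set B := seedBall hconn r u ∪ seedBall hconn r v with hB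
  have hY : Measurable fun z => (F z u, F z v) :=
    (measurable_label hF u).prodMk (measurable_label hF v)
  rw [tsum_eq_sum (s := B) fun j hj => by
    rw [hB, Finset.mem_union, not_or] at hj
    simp [contribution_of_notMem hconn hj.1, contribution_of_notMem hconn hj.2],
    ← ENNReal.ofNNReal_finsetSum, ENNReal.ofReal, ENNReal.coe_le_coe]
  refine NNReal.le_toNNReal_of_coe_le ?_
  have h1 : ∀ j, max (contribution hconn F r j u) (contribution hconn F r j v) ≤
      shapley (fun S : Finset V => info (fun z => (F z u, F z v)) S) j B := fun j =>
    max_le (contribution_le_shapley hconn hY Prod.fst hF (fun _ => rfl)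
        Finset.subset_union_left j)
      (contribution_le_shapley hconn hY Prod.snd hF (fun _ => rfl)
        Finset.subset_union_right j)
  have h2 := Finset.sum_le_sum fun j (_ : j ∈ B) => h1 j
  rw [sum_shapley, Finset.coe_empty, info_empty hY, sub_zero] at h2
  push_cast
  simp only [coe_toNNReal_contribution hconn hF]
  exact h2.trans (info_le_entropy hY _)

theorem add_cheegerConstant_mul_info_le (htrans : IsVertexTransitive G) (hunim : IsUnimodular G)
    {d : ℕ} (hreg : G.IsRegularOfDegree d) (hF : Measurable F) (hequiv : IsEquivariant G F)
    (o : V) (r : ℕ) :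
    ((d : ℝ) + cheegerConstant G) * info (fun z => F z o) (seedBall hconn r o) ≤
      ∑ o' ∈ G.neighborFinset o, entropy (iidLaw V) (fun z => (F z o, F z o')) := by
  set f : V → V → ℝ≥0 := fun j v => (contribution hconn F r j v).toNNReal with hf
  have hinv : ∀ (φ : G ≃g G) j v, f (φ j) (φ v) = f j v := fun φ j v => by
    simp only [hf, contribution_map_iso hconn hF hequiv]
  set κ := ENNReal.ofReal (info (fun z => F z o) (seedBall hconn r o)) with hκ
  have hcol : ∀ v, ∑' j, (f j v : ℝ≥0∞) = κ := by
    intro v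
    obtain ⟨φ, rfl⟩ := htrans o v
    rw [tsum_contribution hconn hF, info_seedBall_map_iso hconn hF hequiv]
  have hrow : ∑' v, (f o v : ℝ≥0∞) = κ := (hunim f hinv o).trans (hcol o)
  have hfin : (Function.support fun v => f o v).Finite := by
    refine (seedBall hconn r o).finite_toSet.subset fun v hv => ?_
    by_contra h
    refine hv ?_
    have : o ∉ seedBall hconn r v := by
      rwa [mem_seedBall, SimpleGraph.dist_comm, ← mem_seedBall hconn]
    simp [hf, contribution_of_notMem hconn this]
  have hexp := mul_tsum_le_tsum_tsub G (fun v => f o v) hfin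
  -- The mass sent from `j` to `v` is the total drop of `f j` from `v` to its neighbors.
  have hflow := hunim (fun j v => ∑ v' ∈ G.neighborFinset v, (f j v - f j v')) (by
    intro φ j v
    refine (Finset.sum_bij (fun a _ => φ a) ?_ ?_ ?_ ?_).symm
    · intro a ha
      simpa [φ.map_adj_iff] using ha
    · intro a _ b _ h
      exact φ.injective h
    · intro b hb
      obtain ⟨a, rfl⟩ := φ.surjective b
      exact ⟨a, by simpa [φ.map_adj_iff] using hb, rfl⟩
    · intro a _
      rw [hinv, hinv]) o
  simp only [ENNReal.ofNNReal_finsetSum] at hflow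
  have hmain : (d + ENNReal.ofReal (cheegerConstant G)) * κ ≤
      ∑ o' ∈ G.neighborFinset o,
        ENNReal.ofReal (entropy (iidLaw V) (fun z => (F z o, F z o'))) := by
    calc (d + ENNReal.ofReal (cheegerConstant G)) * κ
        = ∑ o' ∈ G.neighborFinset o, ∑' j, (f j o' : ℝ≥0∞) +
            ENNReal.ofReal (cheegerConstant G) * ∑' v, (f o v : ℝ≥0∞) := by
          simp only [hcol, hrow, Finset.sum_const, SimpleGraph.card_neighborFinset_eq_degree,
            hreg.degree_eq, nsmul_eq_mul, add_mul]
      _ ≤ ∑ o' ∈ G.neighborFinset o, ∑' j, (f j o' : ℝ≥0∞) +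
            ∑' j, ∑ o' ∈ G.neighborFinset o, ((f j o - f j o' : ℝ≥0) : ℝ≥0∞) :=
          add_le_add le_rfl (hexp.trans_eq hflow)
      _ = ∑ o' ∈ G.neighborFinset o,
            ∑' j, ((max (f j o) (f j o') : ℝ≥0) : ℝ≥0∞) := by
          rw [Summable.tsum_finsetSum fun _ _ => ENNReal.summable, ← Finset.sum_add_distrib]
          refine Finset.sum_congr rfl fun o' _ => ?_
          rw [← ENNReal.tsum_add]
          refine tsum_congr fun j => ?_
          rw [← ENNReal.coe_add, add_tsub_eq_max, max_comm]
      _ ≤ _ := Finset.sum_le_sum fun o' _ => tsum_max_contribution_le hconn hF r o o'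
  have hent : ∀ o', 0 ≤ entropy (iidLaw V) (fun z => (F z o, F z o')) := fun o' =>
    Finset.sum_nonneg fun _ _ => Real.negMulLog_nonneg measureReal_nonneg measureReal_le_one
  have hinfo : 0 ≤ info (fun z => F z o) (seedBall hconn r o) := by
    rw [← sum_contribution hconn hF]
    exact Finset.sum_nonneg fun j _ => contribution_nonneg hconn hF r j o
  rw [← ENNReal.ofReal_sum_of_nonneg fun o' _ => hent o', ← ENNReal.ofReal_natCast,
    ← ENNReal.ofReal_add (Nat.cast_nonneg d) (cheegerConstant_nonneg G), hκ,
    ← ENNReal.ofReal_mul (add_nonneg (Nat.cast_nonneg d) (cheegerConstant_nonneg G))] at hmain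
  exact (ENNReal.ofReal_le_ofReal_iff (Finset.sum_nonneg fun o' _ => hent o')).1 hmain

theorem add_cheegerConstant_mul_entropy_le (hconn : G.Connected) (htrans : IsVertexTransitive G)
    (hunim : IsUnimodular G) {d : ℕ} (hreg : G.IsRegularOfDegree d) (hF : Measurable F)
    (hequiv : IsEquivariant G F) (o : V) :
    ((d : ℝ) + cheegerConstant G) * entropy (iidLaw V) (fun z => F z o) ≤
      ∑ o' ∈ G.neighborFinset o, entropy (iidLaw V) (fun z => (F z o, F z o')) := by
  have h := tendsto_info (B := fun r => (seedBall hconn r o : Set V))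
    (fun r s hrs v hv => (mem_seedBall hconn).2 (((mem_seedBall hconn).1 hv).trans hrs))
    (fun v => ⟨G.dist o v, (mem_seedBall hconn).2 le_rfl⟩) (measurable_label hF o)
  exact le_of_tendsto' (h.const_mul _) fun r =>
    add_cheegerConstant_mul_info_le hconn htrans hunim hreg hF hequiv o r

end Contribution

/-! ### Regular trees are distance-transitive -/

section Tree

variable {V : Type*} {G : SimpleGraph V}

/-- Both neighbors begin a geodesic from `v` to `u`, and paths in a tree are unique. -/
theorem eq_of_adj_of_dist_add_one (hT : G.IsTree) {u v w w' : V} (hw : G.Adj v w)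
    (hd : G.dist u w + 1 = G.dist u v) (hw' : G.Adj v w') (hd' : G.dist u w' + 1 = G.dist u v) :
    w = w' := by
  obtain ⟨p, hp⟩ := hT.connected.exists_walk_length_eq_dist w u
  obtain ⟨p', hp'⟩ := hT.connected.exists_walk_length_eq_dist w' u
  have h1 : (SimpleGraph.Walk.cons hw p).IsPath := by
    apply SimpleGraph.Walk.isPath_of_length_eq_dist
    rw [SimpleGraph.Walk.length_cons, hp, SimpleGraph.dist_comm, hd, SimpleGraph.dist_comm]
  have h2 : (SimpleGraph.Walk.cons hw' p').IsPath := by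
    apply SimpleGraph.Walk.isPath_of_length_eq_dist
    rw [SimpleGraph.Walk.length_cons, hp', SimpleGraph.dist_comm, hd', SimpleGraph.dist_comm]
  have h := congrArg Subtype.val ((hT.isAcyclic.subsingleton_path _ _).elim ⟨_, h1⟩ ⟨_, h2⟩)
  simpa using congrArg SimpleGraph.Walk.snd h

open Classical in
/-- The neighbor of `v` in the direction of `u`. -/
noncomputable def parent (G : SimpleGraph V) (u v : V) : V :=
  if h : ∃ w, G.Adj v w ∧ G.dist u w + 1 = G.dist u v then h.choose else v

theorem parent_spec (hT : G.IsTree) {u v : V} (h : v ≠ u) :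
    G.Adj v (parent G u v) ∧ G.dist u (parent G u v) + 1 = G.dist u v := by
  have he := exists_adj_dist_add_one hT.connected h
  rw [parent, dif_pos he]
  exact he.choose_spec

theorem eq_parent (hT : G.IsTree) {u v w : V} (hw : G.Adj v w)
    (hd : G.dist u w + 1 = G.dist u v) : w = parent G u v := by
  have h : v ≠ u := by
    rintro rfl
    simp at hd
  exact eq_of_adj_of_dist_add_one hT hw hd (parent_spec hT h).1 (parent_spec hT h).2

theorem dist_eq_or_eq_parent (hT : G.IsTree) {u v w : V} (hw : G.Adj v w) :
    G.dist u w = G.dist u v + 1 ∨ w = parent G u v := by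
  rcases hT.dist_eq_dist_add_one_of_adj u hw with h | h
  · exact .inr (eq_parent hT hw h.symm)
  · exact .inl h

/-- The map of a tree that sends `u` to `u'` and is prescribed near each vertex `s` with image
`s'` by the map `E s s'`. -/
noncomputable def treeMap (G : SimpleGraph V) (E : V → V → V → V) (u u' : V) (x : V) : V :=
  if G.dist u (parent G u x) < G.dist u x then
    E (parent G u x) (treeMap G E u u' (parent G u x)) x
  else u'
termination_by G.dist u x

theorem treeMap_root (E : V → V → V → V) (u u' : V) : treeMap G E u u' u = u' := by
  rw [treeMap, if_neg (by simp)]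

theorem treeMap_of_ne (hT : G.IsTree) (E : V → V → V → V) {u x : V} (u' : V) (h : x ≠ u) :
    treeMap G E u u' x = E (parent G u x) (treeMap G E u u' (parent G u x)) x := by
  have := (parent_spec hT h).2
  rw [treeMap, if_pos (by omega)]

theorem exists_bijOn_of_card_eq {A B : Finset V} (hAB : A.card = B.card) {P Q : Prop}
    {a a' b b' : V} (hP : P → a ∈ A ∧ a' ∈ B) (hQ : Q → b ∈ A ∧ b' ∈ B)
    (hPQ : P → Q → a ≠ b ∧ a' ≠ b') :
    ∃ e : V → V, Set.BijOn e A B ∧ (P → e a = a') ∧ (Q → e b = b') := by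
  classical
  have hcard : Fintype.card A = B.card := by simpa using hAB
  obtain ⟨g, hg⟩ := Finset.exists_equiv_extend_of_card_eq (α := A) (t := B) hcard
    (s := Finset.univ.filter fun x => (P ∧ x.1 = a) ∨ (Q ∧ x.1 = b))
    (f := fun x => if P ∧ x.1 = a then a' else b')
    (by
      intro y hy
      obtain ⟨x, hx, rfl⟩ := Finset.mem_image.1 hy
      have := (Finset.mem_filter.1 hx).2
      grind)
    (by
      rintro ⟨x, hx⟩ h1 ⟨y, hy⟩ h2 hxy
      have h1' := (Finset.mem_filter.1 (Finset.mem_coe.1 h1)).2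
      have h2' := (Finset.mem_filter.1 (Finset.mem_coe.1 h2)).2
      simp only at h1' h2' hxy
      ext
      simp only
      grind)
  refine ⟨fun x => if h : x ∈ A then g ⟨x, h⟩ else x, ⟨?_, ?_, ?_⟩, ?_, ?_⟩
  · intro x hx
    rw [Finset.mem_coe] at hx
    simp [hx]
  · intro x hx y hy hxy
    rw [Finset.mem_coe] at hx hy
    simp only [hx, hy, dif_pos] at hxy
    simpa using g.injective (Subtype.ext hxy)
  · intro y hy
    obtain ⟨⟨x, hx⟩, hxy⟩ := g.surjective ⟨y, hy⟩
    exact ⟨x, hx, by simp [hx, hxy]⟩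
  · intro h
    have := hg ⟨a, (hP h).1⟩ (by simp [h])
    simp only [(hP h).1, dif_pos, this]
    simp [h]
  · intro h
    have := hg ⟨b, (hQ h).1⟩ (by simp [h])
    simp only [(hQ h).1, dif_pos, this]
    rw [if_neg]
    rintro ⟨h', rfl⟩
    exact (hPQ h' h).1 rfl

/-- A common parent would be nearer to both ends than `s`, giving a route from `u` to `v` shorter
than their distance. -/
theorem parent_ne_parent (hT : G.IsTree) {u v s : V} (hu : s ≠ u) (hv : s ≠ v)
    (hs : G.dist u s + G.dist v s = G.dist u v) : parent G u s ≠ parent G v s := by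
  intro h
  have h1 := (parent_spec hT hu).2
  have h2 := (parent_spec hT hv).2
  have h3 : G.dist u v ≤ G.dist u (parent G u s) + G.dist (parent G u s) v :=
    hT.connected.dist_triangle
  rw [← h] at h2
  rw [SimpleGraph.dist_comm (u := parent G u s) (v := v)] at h3
  omega

variable [G.LocallyFinite] {d : ℕ}

/-- Data for building an automorphism outward from `u`: the first constraint keeps parents, so that
the map is radial; the second sends the next step of the geodesic to `v` to that of the geodesic to
`v'`. -/
theorem exists_local_bijections (hT : G.IsTree) (hreg : G.IsRegularOfDegree d) (u v u' v' : V) :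
    ∃ E : V → V → V → V, ∀ s s',
      Set.BijOn (E s s') (G.neighborFinset s) (G.neighborFinset s') ∧
      (s ≠ u ∧ s' ≠ u' → E s s' (parent G u s) = parent G u' s') ∧
      ((s ≠ v ∧ G.dist u s + G.dist v s = G.dist u v) ∧
        (s' ≠ v' ∧ G.dist u' s' + G.dist v' s' = G.dist u' v') →
          E s s' (parent G v s) = parent G v' s') := by
  have h : ∀ s s', _ := fun s s' => exists_bijOn_of_card_eq
    (A := G.neighborFinset s) (B := G.neighborFinset s')
    (P := s ≠ u ∧ s' ≠ u') (a := parent G u s) (a' := parent G u' s')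
    (Q := (s ≠ v ∧ G.dist u s + G.dist v s = G.dist u v) ∧
        (s' ≠ v' ∧ G.dist u' s' + G.dist v' s' = G.dist u' v'))
    (b := parent G v s) (b' := parent G v' s')
    (by simp only [SimpleGraph.card_neighborFinset_eq_degree, hreg.degree_eq])
    (fun h => ⟨by simpa using (parent_spec hT h.1).1, by simpa using (parent_spec hT h.2).1⟩)
    (fun h => ⟨by simpa using (parent_spec hT h.1.1).1, by simpa using (parent_spec hT h.2.1).1⟩)
    (fun h h' => ⟨parent_ne_parent hT h.1 h'.1.1 h'.1.2, parent_ne_parent hT h.2 h'.2.1 h'.2.2⟩)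
  choose E hE using h
  exact ⟨E, hE⟩

/-- A regular tree is distance-transitive. -/
theorem exists_iso_of_dist_eq (hT : G.IsTree) (hreg : G.IsRegularOfDegree d) {u v u' v' : V}
    (huv : G.dist u v = G.dist u' v') : ∃ φ : G ≃g G, φ u = u' ∧ φ v = v' := by
  obtain ⟨E, hE⟩ := exists_local_bijections hT hreg u v u' v'
  set f := treeMap G E u u' with hf
  have hroot : f u = u' := treeMap_root E u u'
  have hne : ∀ {x}, x ≠ u → f x = E (parent G u x) (f (parent G u x)) x := fun h =>
    treeMap_of_ne hT E u' h
  have hzero : ∀ {a b : V}, G.dist a b = 0 → b = a := fun h =>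
    (hT.connected.dist_eq_zero_iff.1 h).symm
  have main : ∀ n x, G.dist u x = n →
      G.dist u' (f x) = n ∧ (x ≠ u → parent G u' (f x) = f (parent G u x)) := by
    intro n
    induction n with
    | zero =>
      intro x hx
      obtain rfl := hzero hx
      simp [hroot]
    | succ n ih =>
      intro x hx
      have hxu : x ≠ u := by
        rintro rfl
        simp at hx
      obtain ⟨hadj, hd⟩ := parent_spec hT hxu
      set s := parent G u x with hs
      have hds : G.dist u s = n := by omega
      have hfs := (ih s hds).1
      have hxN : x ∈ (G.neighborFinset s : Set V) := by simpa using hadj.symm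
      have hy : G.Adj (f s) (f x) := by
        rw [hne hxu]
        simpa using (hE s (f s)).1.mapsTo hxN
      have hdy : G.dist u' (f x) = n + 1 := by
        rcases hT.dist_eq_dist_add_one_of_adj u' hy with h | h
        -- If `f x` were nearer to `u'` than `f s`, it would be the image of the parent of `s`;
        -- local injectivity would make `x` that parent, contradicting its distance from `u`.
        · have hs'u : f s ≠ u' := by
            intro h'
            rw [h'] at h
            simp at h
          have hsu : s ≠ u := by
            intro h'
            exact hs'u (h' ▸ hroot)
          have h1 := (hE s (f s)).2.1 ⟨hsu, hs'u⟩
          rw [← eq_parent hT hy h.symm, hne hxu] at h1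
          have h2 := (hE s (f s)).1.injOn (by simpa using (parent_spec hT hsu).1) hxN h1
          have h3 := (parent_spec hT hsu).2
          rw [h2] at h3
          omega
        · omega
      exact ⟨hdy, fun _ => (eq_parent hT hy.symm (by omega)).symm⟩
  have hdist : ∀ x, G.dist u' (f x) = G.dist u x := fun x => (main _ x rfl).1
  have hpar : ∀ {x}, x ≠ u → parent G u' (f x) = f (parent G u x) := fun h => (main _ _ rfl).2 h
  have hne' : ∀ {x}, x ≠ u → f x ≠ u' := by
    intro x hx h
    have := hdist x
    rw [h, SimpleGraph.dist_self] at this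
    exact hx (hzero this.symm)
  have hinj : ∀ n x y, G.dist u x = n → f x = f y → x = y := by
    intro n
    induction n with
    | zero =>
      intro x y hx hxy
      have hy : G.dist u y = 0 := by rw [← hdist, ← hxy, hdist, hx]
      rw [hzero hx, hzero hy]
    | succ n ih =>
      intro x y hx hxy
      have hy : G.dist u y = n + 1 := by rw [← hdist, ← hxy, hdist, hx]
      have hxu : x ≠ u := by
        rintro rfl
        simp at hx
      have hyu : y ≠ u := by
        rintro rfl
        simp at hy
      have hp : parent G u x = parent G u y := by
        refine ih _ _ ?_ ?_
        · have := (parent_spec hT hxu).2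
          omega
        · rw [← hpar hxu, ← hpar hyu, hxy]
      rw [hne hxu, hne hyu, ← hp] at hxy
      refine (hE _ _).1.injOn ?_ ?_ hxy
      · simpa using (parent_spec hT hxu).1.symm
      · rw [hp]
        simpa using (parent_spec hT hyu).1.symm
  have hinj' : Function.Injective f := fun x y => hinj _ x y rfl
  have hsurj : ∀ n y, G.dist u' y = n → ∃ x, f x = y := by
    intro n
    induction n with
    | zero =>
      intro y hy
      exact ⟨u, by rw [hroot, hzero hy]⟩
    | succ n ih =>
      intro y hy
      have hyu : y ≠ u' := by
        rintro rfl
        simp at hy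
      obtain ⟨hadj, hd⟩ := parent_spec hT hyu
      obtain ⟨s, hs⟩ := ih (parent G u' y) (by omega)
      obtain ⟨x, hx, hxy⟩ := (hE s (f s)).1.surjOn
        (show y ∈ (G.neighborFinset (f s) : Set V) by simpa [hs] using hadj.symm)
      have hsx : G.Adj s x := by simpa using hx
      have hxd : G.dist u x = G.dist u s + 1 := by
        rcases dist_eq_or_eq_parent hT (u := u) hsx with h | h
        · exact h
        · exfalso
          by_cases hsu : s = u
          · have h1 := hT.connected.dist_eq_zero_iff.2 hsu
            -- At the root `parent` takes its default value, the root itself, which is not adjacent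
            -- to itself.
            have h2 : parent G u s = s := by
              rw [hsu, parent, dif_neg]
              simp
            exact hsx.ne (h2 ▸ h.symm)
          · have h1 := (hE s (f s)).2.1 ⟨hsu, hne' hsu⟩
            rw [← h, hxy] at h1
            have h2 := (parent_spec hT (hne' hsu)).2
            rw [← h1, hs] at h2
            omega
      have hxu : x ≠ u := by
        rintro rfl
        simp at hxd
      have hsp := eq_parent hT hsx.symm hxd.symm
      exact ⟨x, by rw [hne hxu, ← hsp, hxy]⟩
  have hadj : ∀ {x y}, G.Adj x y → G.dist u y = G.dist u x + 1 → G.Adj (f x) (f y) := by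
    intro x y hxy hd
    have hyu : y ≠ u := by
      rintro rfl
      simp at hd
    have h1 := (parent_spec hT (hne' hyu)).1
    rw [hpar hyu, ← eq_parent hT hxy.symm hd.symm] at h1
    exact h1.symm
  have hadj' : ∀ {x y}, G.Adj (f x) (f y) → G.dist u y = G.dist u x + 1 → G.Adj x y := by
    intro x y hxy hd
    have hyu : y ≠ u := by
      rintro rfl
      simp at hd
    have h1 := eq_parent hT hxy.symm (u := u') (by rw [hdist, hdist, hd])
    rw [hpar hyu] at h1
    rw [hinj' h1]
    exact (parent_spec hT hyu).1.symm
  have hiff : ∀ x y, G.Adj (f x) (f y) ↔ G.Adj x y := by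
    intro x y
    constructor
    · intro h
      rcases hT.dist_eq_dist_add_one_of_adj u' h with h' | h' <;> rw [hdist, hdist] at h'
      · exact (hadj' h.symm h').symm
      · exact hadj' h h'
    · intro h
      rcases hT.dist_eq_dist_add_one_of_adj u h with h' | h'
      · exact (hadj h.symm h').symm
      · exact hadj h h'
  -- Along the geodesic from `u` to `v`, the second constraint on `E` keeps the distance to the
  -- target; at `s = v` this yields `f v = v'`.
  have hgeo : ∀ n s, G.dist u s = n → G.dist u s + G.dist v s = G.dist u v →
      G.dist v' (f s) = G.dist v s := by
    intro n
    induction n with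
    | zero =>
      intro s hs _
      rw [hzero hs, hroot, SimpleGraph.dist_comm, ← huv, SimpleGraph.dist_comm]
    | succ n ih =>
      intro s hs hsum
      have hsu : s ≠ u := by
        rintro rfl
        simp at hs
      obtain ⟨hst, hd⟩ := parent_spec hT hsu
      set t := parent G u s with ht
      have h1 : G.dist u v ≤ G.dist u t + G.dist t v := hT.connected.dist_triangle
      have h2 : G.dist v t ≤ G.dist v s + G.dist s t := hT.connected.dist_triangle
      rw [SimpleGraph.dist_eq_one_iff_adj.2 hst] at h2
      rw [SimpleGraph.dist_comm (u := t)] at h1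
      have htv : G.dist v s + 1 = G.dist v t := by omega
      have ih' := ih t (by omega) (by omega)
      have hsp := eq_parent hT hst.symm htv
      have htv' : t ≠ v := by
        rintro h
        rw [h] at htv
        simp at htv
      have hftv : f t ≠ v' := by
        intro h
        rw [h, SimpleGraph.dist_self] at ih'
        omega
      have h3 := (hE t (f t)).2.2 ⟨⟨htv', by omega⟩, hftv, by rw [hdist, ih', ← huv]; omega⟩
      rw [← hsp, ← hne hsu] at h3
      have h4 := (parent_spec hT hftv).2
      rw [← h3] at h4
      omega
  refine ⟨⟨Equiv.ofBijective f ⟨hinj', fun y => hsurj _ y rfl⟩, hiff _ _⟩, hroot, ?_⟩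
  have := hgeo _ v rfl (by simp)
  rw [SimpleGraph.dist_self] at this
  exact hzero this

theorem isVertexTransitive_of_isTree (hT : G.IsTree) (hreg : G.IsRegularOfDegree d) :
    IsVertexTransitive G := fun u v => by
  obtain ⟨φ, h, -⟩ := exists_iso_of_dist_eq hT hreg (u := u) (v := u) (u' := v) (v' := v) (by simp)
  exact ⟨φ, h⟩

/-- Some automorphism swaps `o` and `v`, so the two sums agree term by term. -/
theorem isUnimodular_of_isTree (hT : G.IsTree) (hreg : G.IsRegularOfDegree d) :
    IsUnimodular G := fun h hh o => by
  refine tsum_congr fun v => ?_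
  obtain ⟨φ, h1, h2⟩ := exists_iso_of_dist_eq hT hreg (u := o) (v := v) (u' := v) (v' := o)
    SimpleGraph.dist_comm
  rw [← hh φ o v, h1, h2]

end Tree

/-! ### The Cheeger constant of a regular tree -/

section TreeCheeger

variable {V : Type*} {G : SimpleGraph V} [G.LocallyFinite] {d : ℕ}

-- Root the tree at some `r ∈ W`. Each edge inside `W` joins a vertex other than `r` to its parent,
-- so there are at most `|W| - 1` edges, each counted in both directions.
open Classical in
theorem sum_card_inner_neighbors_add_two_le (hT : G.IsTree) {W : Finset V} (hW : W.Nonempty) :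
    ∑ v ∈ W, ((G.neighborFinset v).filter (· ∈ W)).card + 2 ≤ 2 * W.card := by
  obtain ⟨r, hr⟩ := hW
  have hsub : (W.sigma fun v => (G.neighborFinset v).filter (· ∈ W)) ⊆
      ((W.erase r).image fun v => ⟨v, parent G r v⟩) ∪
        ((W.erase r).image fun v => ⟨parent G r v, v⟩) := by
    rintro ⟨v, w⟩ hvw
    simp only [Finset.mem_sigma, Finset.mem_filter, SimpleGraph.mem_neighborFinset] at hvw
    obtain ⟨hv, hadj, hw⟩ := hvw
    rw [Finset.mem_union, Finset.mem_image, Finset.mem_image]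
    rcases hT.dist_eq_dist_add_one_of_adj r hadj with h | h
    · refine .inl ⟨v, Finset.mem_erase.2 ⟨?_, hv⟩, ?_⟩
      · rintro rfl
        simp at h
      · rw [← eq_parent hT hadj h.symm]
    · refine .inr ⟨w, Finset.mem_erase.2 ⟨?_, hw⟩, ?_⟩
      · rintro rfl
        simp at h
      · rw [← eq_parent hT hadj.symm h.symm]
  have h1 := (Finset.card_le_card hsub).trans (Finset.card_union_le _ _)
  have h2 := Finset.card_image_le (s := W.erase r)
    (f := fun v => (⟨v, parent G r v⟩ : Σ _ : V, V))
  have h3 := Finset.card_image_le (s := W.erase r)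
    (f := fun v => (⟨parent G r v, v⟩ : Σ _ : V, V))
  rw [Finset.card_sigma] at h1
  rw [Finset.card_erase_of_mem hr] at h2 h3
  have := Finset.card_pos.2 ⟨r, hr⟩
  omega

theorem mul_card_add_two_le (hT : G.IsTree) (hreg : G.IsRegularOfDegree d) {W : Finset V}
    (hW : W.Nonempty) : d * W.card + 2 ≤ 2 * W.card + (edgeBoundary G W).ncard := by
  classical
  have h1 := sum_card_inner_neighbors_add_two_le hT hW
  have h2 : ∑ v ∈ W, ((G.neighborFinset v).filter (· ∈ W)).card +
      (edgeBoundary G W).ncard = d * W.card := by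
    rw [ncard_edgeBoundary, ← Finset.sum_add_distrib, mul_comm, ← smul_eq_mul, ← Finset.sum_const]
    refine Finset.sum_congr rfl fun v _ => ?_
    rw [Finset.card_filter_add_card_filter_not, SimpleGraph.card_neighborFinset_eq_degree,
      hreg.degree_eq]
  omega

/-- Grow `W` by the outer endpoint of a boundary edge: that edge is lost and at most `d - 1` edges
are gained. Since `d ≥ 2`, the lower bound on boundaries ensures that such an edge exists. -/
theorem exists_card_eq_and_ncard_edgeBoundary_le (hT : G.IsTree) (hreg : G.IsRegularOfDegree d)
    (hd : 2 ≤ d) (n : ℕ) : ∃ W : Finset V, W.card = n + 1 ∧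
      (edgeBoundary G W).ncard + 2 * (n + 1) ≤ d * (n + 1) + 2 := by
  classical
  induction n with
  | zero =>
    obtain ⟨o⟩ := hT.connected.nonempty
    refine ⟨{o}, by simp, ?_⟩
    rw [ncard_edgeBoundary, Finset.sum_singleton]
    have := Finset.card_filter_le (G.neighborFinset o) (· ∉ ({o} : Finset V))
    rw [SimpleGraph.card_neighborFinset_eq_degree, hreg.degree_eq] at this
    omega
  | succ n ih =>
    obtain ⟨W, hW, hle⟩ := ih
    have hne : W.Nonempty := Finset.card_pos.1 (by omega)
    have h1 := mul_card_add_two_le hT hreg hne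
    have hpos : (edgeBoundary G W).ncard ≠ 0 := by
      have := Nat.mul_le_mul_right W.card hd
      omega
    rw [ncard_edgeBoundary] at hpos hle
    obtain ⟨s, hs, hs'⟩ := Finset.exists_ne_zero_of_sum_ne_zero hpos
    obtain ⟨x, hx⟩ := Finset.card_pos.1 (Nat.pos_of_ne_zero hs')
    rw [Finset.mem_filter, SimpleGraph.mem_neighborFinset] at hx
    obtain ⟨hsx, hxW⟩ := hx
    refine ⟨insert x W, by rw [Finset.card_insert_of_notMem hxW, hW], ?_⟩
    rw [ncard_edgeBoundary, Finset.sum_insert hxW]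
    have h2 : ((G.neighborFinset x).filter (· ∉ insert x W)).card < d := by
      rw [← hreg.degree_eq x, ← SimpleGraph.card_neighborFinset_eq_degree]
      refine Finset.card_lt_card (Finset.filter_ssubset.2 ⟨s, ?_, ?_⟩)
      · simpa using hsx.symm
      · simp [hs]
    have hsub : ∀ v, (G.neighborFinset v).filter (· ∉ insert x W) ⊆
        (G.neighborFinset v).filter (· ∉ W) := fun v =>
      Finset.monotone_filter_right _ fun a _ ha h => ha (Finset.mem_insert_of_mem h)
    have h3 : ∑ v ∈ W, ((G.neighborFinset v).filter (· ∉ insert x W)).card <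
        ∑ v ∈ W, ((G.neighborFinset v).filter (· ∉ W)).card := by
      refine Finset.sum_lt_sum (fun v _ => Finset.card_le_card (hsub v)) ⟨s, hs, ?_⟩
      refine Finset.card_lt_card ((hsub s).ssubset_of_mem_notMem (a := x) ?_ ?_)
      · simp [hsx, hxW]
      · simp
    have h4 : d * (n + 1 + 1) = d * (n + 1) + d := by ring
    omega

/-- The edge Cheeger constant of the `d`-regular tree. -/
theorem cheegerConstant_of_isTree (hT : G.IsTree) (hreg : G.IsRegularOfDegree d) (hd : 2 ≤ d) :
    cheegerConstant G = (d : ℝ) - 2 := by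
  obtain ⟨o⟩ := hT.connected.nonempty
  refine le_antisymm ?_ ?_
  · have hn : ∀ n : ℕ, cheegerConstant G ≤ (d : ℝ) - 2 + 2 * (1 / ((n : ℝ) + 1)) := by
      intro n
      obtain ⟨W, hW, hle⟩ := exists_card_eq_and_ncard_edgeBoundary_le hT hreg hd n
      have h := cheegerConstant_mul_card_le G W
      have hle' : ((edgeBoundary G W).ncard : ℝ) + 2 * (n + 1) ≤ d * (n + 1) + 2 := by
        exact_mod_cast hle
      rw [hW] at h
      push_cast at h
      have hpos : (0 : ℝ) < n + 1 := by positivity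
      refine le_of_mul_le_mul_right ?_ hpos
      have : ((d : ℝ) - 2 + 2 * (1 / ((n : ℝ) + 1))) * (n + 1) = (d - 2) * (n + 1) + 2 := by
        field_simp
      rw [this]
      linarith
    have ht := ((tendsto_one_div_add_atTop_nhds_zero_nat (𝕜 := ℝ)).const_mul 2).const_add
      ((d : ℝ) - 2)
    rw [mul_zero, add_zero] at ht
    exact ge_of_tendsto' ht hn
  · have : Nonempty {W : Finset V // W.Nonempty} := ⟨⟨{o}, by simp⟩⟩
    refine le_ciInf fun ⟨W, hW⟩ => ?_
    have hpos : (0 : ℝ) < W.card := by exact_mod_cast hW.card_pos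
    rw [le_div_iff₀ hpos]
    have h : (d : ℝ) * W.card + 2 ≤ 2 * W.card + (edgeBoundary G W).ncard := by
      exact_mod_cast mul_card_add_two_le hT hreg hW
    linarith

end TreeCheeger

/-! ### Transfer to the given process and conclusion -/

theorem entropy_comp_of_identDistrib {α N Ω Ω' : Type*} [Fintype N] [MeasurableSpace N]
    [MeasurableSingletonClass N] [MeasurableSpace α] [MeasurableSpace Ω] [MeasurableSpace Ω']
    {P : Measure Ω} {Q : Measure Ω'} {X : Ω → α} {Y : Ω' → α} (h : IdentDistrib X Y P Q)
    {g : α → N} (hg : Measurable g) :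
    entropy P (fun ω => g (X ω)) = entropy Q (fun ω => g (Y ω)) := by
  unfold entropy
  refine Finset.sum_congr rfl fun n _ => ?_
  congr 1
  exact congrArg ENNReal.toReal ((h.comp hg).measure_mem_eq (measurableSet_singleton n))

end FactorOfIID

theorem theorem2 {V M Ω : Type*} [Fintype M] [MeasurableSpace M] [MeasurableSingletonClass M]
    [MeasurableSpace Ω] (P : Measure Ω) [IsProbabilityMeasure P]
    (G : SimpleGraph V) [G.LocallyFinite] (d : ℕ)
    (hconn : G.Connected) (hreg : G.IsRegularOfDegree d)
    (X : V → Ω → M) (hX : FactorOfIID.IsFactorOfIID G P X) :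
    (FactorOfIID.IsVertexTransitive G → FactorOfIID.IsUnimodular G →
      ∀ o : V,
        (1 / 2 : ℝ) * ∑ o' ∈ G.neighborFinset o,
            FactorOfIID.entropy P (fun ω => (X o ω, X o' ω)) ≥
          (1 / 2 : ℝ) * ((d : ℝ) + FactorOfIID.cheegerConstant G) *
            FactorOfIID.entropy P (X o)) ∧
    (G.IsTree → 2 ≤ d →
      FactorOfIID.cheegerConstant G = (d : ℝ) - 2 ∧
      ∀ u v : V, G.Adj u v →
        FactorOfIID.entropy P (fun ω => (X u ω, X v ω)) ≥
          2 * ((d : ℝ) - 1) / (d : ℝ) * FactorOfIID.entropy P (X v)) := by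
  obtain ⟨F, hF, hequiv, hid⟩ := hX
  have h1 : ∀ v, FactorOfIID.entropy P (X v) =
      FactorOfIID.entropy (FactorOfIID.iidLaw V) (fun z => F z v) := fun v =>
    FactorOfIID.entropy_comp_of_identDistrib hid (g := fun x => x v) (measurable_pi_apply v)
  have h2 : ∀ u v, FactorOfIID.entropy P (fun ω => (X u ω, X v ω)) =
      FactorOfIID.entropy (FactorOfIID.iidLaw V) (fun z => (F z u, F z v)) := fun u v =>
    FactorOfIID.entropy_comp_of_identDistrib hid (g := fun x => (x u, x v))
      ((measurable_pi_apply u).prodMk (measurable_pi_apply v))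
  simp only [h1, h2]
  refine ⟨fun htrans hunim o => ?_, fun hT hd => ?_⟩
  · have := FactorOfIID.add_cheegerConstant_mul_entropy_le hconn htrans hunim hreg hF hequiv o
    linarith
  · have hc := FactorOfIID.cheegerConstant_of_isTree hT hreg hd
    refine ⟨hc, fun u v huv => ?_⟩
    have h := FactorOfIID.add_cheegerConstant_mul_entropy_le hconn
      (FactorOfIID.isVertexTransitive_of_isTree hT hreg)
      (FactorOfIID.isUnimodular_of_isTree hT hreg) hreg hF hequiv v
    -- An automorphism carries `(v, w)` to `(u, v)`, so all `d` terms around `v` coincide, and `d +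
    -- (d - 2) = 2 * (d - 1)` gives the constant.
    have hsame : ∀ w ∈ G.neighborFinset v,
        FactorOfIID.entropy (FactorOfIID.iidLaw V) (fun z => (F z v, F z w)) =
          FactorOfIID.entropy (FactorOfIID.iidLaw V) (fun z => (F z u, F z v)) := by
      intro w hw
      have hvw : G.Adj v w := by simpa using hw
      obtain ⟨φ, hu, hv⟩ := FactorOfIID.exists_iso_of_dist_eq hT hreg (u := v) (v := w) (u' := u)
        (v' := v) (by rw [SimpleGraph.dist_eq_one_iff_adj.2 hvw,
          SimpleGraph.dist_eq_one_iff_adj.2 huv])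
      rw [← FactorOfIID.entropy_map_iso hF hequiv φ, hu, hv]
    rw [Finset.sum_congr rfl hsame, Finset.sum_const, SimpleGraph.card_neighborFinset_eq_degree,
      hreg.degree_eq, nsmul_eq_mul, hc] at h
    have hd0 : (0 : ℝ) < d := by exact_mod_cast (by omega : 0 < d)
    rw [ge_iff_le, div_mul_eq_mul_div, div_le_iff₀ hd0]
    linarith
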